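/- Let $A\in\mathrm{GL}_4(\mathbb Z)$ be hyperbolic, i.e. its characteristic polynomial is irreducible over $\mathbb Q$ and has only real roots, and let $l_1,\dots,l_4\subset\mathbb R^4$ be its four (one-dimensional) eigenspaces, numbered in any order; suppose that $l_1$ is spanned by $(1,\alpha,\beta,\gamma)$. The hyperplanes spanned by triples of the lines $l_i$ cut $\mathbb R^4$ into $16$ simplicial cones $C$. The sail of $C$ is the boundary of the convex hull of the nonzero points of $C\cap\mathbb Z^4$, and the algebraic continued fraction $\mathrm{CF}(l_1,\dots,l_4)$ is the union of the $16$ sails. A symmetry of it is a $G\in\mathrm{GL}_4(\mathbb Z)$ with $G(\mathrm{CF}(l_1,\dots,l_4))=\mathrm{CF}(l_1,\dots,l_4)$. It is cyclic if $G(l_i)=l_{\sigma_G(i)}$ for all $i$, where $\sigma_G$ is a $4$-cycle, and a cyclic symmetry is proper if it has a fixed point on some sail. For $v,w\in\mathbb R^4$ write $v\sim w$ if $Xv=\mu w$ for some $X\in\mathrm{GL}_4(\mathbb Z)$ and some real $\mu\ne0$. Then $\mathrm{CF}(l_1,\dots,l_4)$ has a proper cyclic symmetry if and only if there is a real algebraic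 number $\omega$ of degree $4$ with conjugates $\omega,\omega',\omega'',\omega'''$, all real and numbered cyclically (that is, some automorphism of the field $\mathbb Q(\omega,\omega',\omega'',\omega''')$ maps $\omega\mapsto\omega'\mapsto\omega''\mapsto\omega'''\mapsto\omega$), such that at least one of the following holds, where $\mathrm{Tr}(\omega)=\omega+\omega'+\omega''+\omega'''$: 1. $(1,\alpha,\beta,\gamma)\sim(1,\omega,\omega',\omega'')$ and $\mathrm{Tr}(\omega)=0$; 2. $(1,\alpha,\beta,\gamma)\sim(1,\omega,\omega',\omega'')$ and $\mathrm{Tr}(\omega)=1$; 3. $(1,\alpha,\beta,\gamma)\sim(1,\omega,\omega',\omega'')$ and $\mathrm{Tr}(\omega)=2$; 4. $(1,\alpha,\beta,\gamma)\sim(1,\omega,\omega',\frac{\omega+\omega''}{2})$ and $\mathrm{Tr}(\omega)=0$; 5. $(1,\alpha,\beta,\gamma)\sim(1,\omega,\omega',\frac{\omega+\omega''}{2})$ and $\mathrm{Tr}(\omega)=2$; 6. $(1,\alpha,\beta,\gamma)\sim(1,\omega,\omega',\frac{\omega+\omega''+1}{2})$ and $\mathrm{Tr}(\omega)=0$; 7.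 $(1,\alpha,\beta,\gamma)\sim(1,\omega,\omega',\frac{\omega+\omega''+1}{2})$ and $\mathrm{Tr}(\omega)=2$. Moreover, if one of these conditions holds, then $\mathbb Q(\alpha,\beta,\gamma)$ is a normal extension of $\mathbb Q$ of degree $4$. -/

import Mathlib

open scoped Polynomial

namespace KleinCF

noncomputable section

/-- The linear operator on `ℝⁿ` given by an integer matrix `G ∈ GL_n(ℤ)`. -/
def act {n : ℕ} (G : Matrix.GeneralLinearGroup (Fin n) ℤ) :
    (Fin n → ℝ) →ₗ[ℝ] (Fin n → ℝ) :=
  Matrix.toLin' ((G : Matrix (Fin n) (Fin n) ℤ).map (Int.castRingHom ℝ))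

/-- The integer points `ℤⁿ ⊆ ℝⁿ`. -/
def integerPoints (n : ℕ) : Set (Fin n → ℝ) :=
  Set.range fun (z : Fin n → ℤ) (i : Fin n) => (z i : ℝ)

/-- The (closed) simplicial cones into which the hyperplanes spanned by all `(n-1)`-tuples of
the lines `l i` cut `ℝⁿ`: one chooses one of the two rays of each line and takes the conical
hull of the chosen rays. -/
def cones {n : ℕ} (l : Fin n → Submodule ℝ (Fin n → ℝ)) : Set (Set (Fin n → ℝ)) :=
  {C | ∃ v : Fin n → (Fin n → ℝ), (∀ i, l i = Submodule.span ℝ {v i}) ∧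
    C = {x | ∃ c : Fin n → ℝ, (∀ i, 0 ≤ c i) ∧ x = ∑ i, c i • v i}}

/-- The Klein polyhedron of a cone: the convex hull of its nonzero integer points. -/
def kleinPolyhedron {n : ℕ} (C : Set (Fin n → ℝ)) : Set (Fin n → ℝ) :=
  convexHull ℝ ((C ∩ integerPoints n) \ {0})

/-- The Klein sail of a cone: the boundary of its Klein polyhedron. -/
def sail {n : ℕ} (C : Set (Fin n → ℝ)) : Set (Fin n → ℝ) :=
  frontier (kleinPolyhedron C)

/-- The `(n-1)`-dimensional continued fraction `CF(l₁, …, lₙ)`: the union of the sails of all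
the cones of `l₁, …, lₙ`. -/
def CF {n : ℕ} (l : Fin n → Submodule ℝ (Fin n → ℝ)) : Set (Fin n → ℝ) :=
  ⋃ C ∈ cones l, sail C

/-- Hyperbolic operators: elements of `GL_n(ℤ)` with real eigenvalues whose characteristic
polynomial is irreducible over `ℚ`. -/
def IsHyperbolic {n : ℕ} (A : Matrix.GeneralLinearGroup (Fin n) ℤ) : Prop :=
  Irreducible ((A : Matrix (Fin n) (Fin n) ℤ).charpoly.map (Int.castRingHom ℚ)) ∧
  ((A : Matrix (Fin n) (Fin n) ℤ).charpoly.map (Int.castRingHom ℝ)).Splits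

/-- `CF(l₁, …, lₙ)` is algebraic: `l₁, …, lₙ` are the (pairwise different) eigenspaces of some
hyperbolic operator `A ∈ GL_n(ℤ)`. -/
def IsAlgebraicCF {n : ℕ} (l : Fin n → Submodule ℝ (Fin n → ℝ)) : Prop :=
  ∃ A : Matrix.GeneralLinearGroup (Fin n) ℤ, IsHyperbolic A ∧
    ∃ ev : Fin n → ℝ, Function.Injective ev ∧
      ∀ i, Module.End.HasEigenvalue (act A) (ev i) ∧ l i = Module.End.eigenspace (act A) (ev i)

/-- `G ∈ GL_n(ℤ)` is a symmetry of `CF(l₁, …, lₙ)`. -/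
def IsSymmetry {n : ℕ} (l : Fin n → Submodule ℝ (Fin n → ℝ))
    (G : Matrix.GeneralLinearGroup (Fin n) ℤ) : Prop :=
  act G '' CF l = CF l

/-- `G` permutes the lines by `s`, that is, `G(l i) = l (s i)` for all `i`. -/
def PermutesBy {n : ℕ} (l : Fin n → Submodule ℝ (Fin n → ℝ))
    (G : Matrix.GeneralLinearGroup (Fin n) ℤ) (s : Equiv.Perm (Fin n)) : Prop :=
  ∀ i, (l i).map (act G) = l (s i)

/-- Dirichlet symmetries: the permutation of the lines is the identity. -/
def IsDirichlet {n : ℕ} (l : Fin n → Submodule ℝ (Fin n → ℝ))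
    (G : Matrix.GeneralLinearGroup (Fin n) ℤ) : Prop :=
  IsSymmetry l G ∧ PermutesBy l G 1

/-- Palindromic symmetries: those which are not Dirichlet symmetries. -/
def IsPalindromic {n : ℕ} (l : Fin n → Submodule ℝ (Fin n → ℝ))
    (G : Matrix.GeneralLinearGroup (Fin n) ℤ) : Prop :=
  IsSymmetry l G ∧ ¬ IsDirichlet l G

/-- Cyclic symmetries: the lines are permuted by a cycle of length `n`. -/
def IsCyclicSymmetry {n : ℕ} (l : Fin n → Submodule ℝ (Fin n → ℝ))
    (G : Matrix.GeneralLinearGroup (Fin n) ℤ) : Prop :=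
  IsSymmetry l G ∧
    ∃ s : Equiv.Perm (Fin n), s.IsCycle ∧ s.support = Finset.univ ∧ PermutesBy l G s

/-- Proper symmetries: palindromic symmetries with a fixed point on some sail. -/
def IsProper {n : ℕ} (l : Fin n → Submodule ℝ (Fin n → ℝ))
    (G : Matrix.GeneralLinearGroup (Fin n) ℤ) : Prop :=
  IsPalindromic l G ∧ ∃ C ∈ cones l, ∃ x ∈ sail C, act G x = x

/-- `CF(l₁, …, lₙ)` has a proper cyclic symmetry. -/
def HasProperCyclicSymmetry {n : ℕ} (l : Fin n → Submodule ℝ (Fin n → ℝ)) : Prop :=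
  ∃ G : Matrix.GeneralLinearGroup (Fin n) ℤ, IsCyclicSymmetry l G ∧ IsProper l G

/-- `v ∼ w`: there are `X ∈ GL_n(ℤ)` and a real `μ ≠ 0` with `X v = μ w`. -/
def Equivalent {n : ℕ} (v w : Fin n → ℝ) : Prop :=
  ∃ X : Matrix.GeneralLinearGroup (Fin n) ℤ, ∃ μ : ℝ, μ ≠ 0 ∧ act X v = μ • w

/-- `w 0` is a (real) algebraic number of degree `4`, the numbers `w 0, w 1, w 2, w 3` are all
its conjugates, and they are numbered cyclically: some automorphism of the field
`ℚ(w 0, w 1, w 2, w 3)` maps `w 0 ↦ w 1 ↦ w 2 ↦ w 3 ↦ w 0` (the index `i + 1` is taken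
modulo `4`). -/
def IsCyclicConjugates (w : Fin 4 → ℝ) : Prop :=
  (minpoly ℚ (w 0)).map (algebraMap ℚ ℝ) = ∏ i, (Polynomial.X - Polynomial.C (w i)) ∧
  ∃ s : IntermediateField.adjoin ℚ (Set.range w) ≃ₐ[ℚ] IntermediateField.adjoin ℚ (Set.range w),
    ∀ i, (s ⟨w i, IntermediateField.subset_adjoin ℚ _ ⟨i, rfl⟩⟩ : ℝ) = w (i + 1)

/-- The seven normal forms, for a vector `v` and numbers `a = ω`, `b = ω'`, `c = ω''`,
`d = ω'''`. -/
def NormalForm (v : Fin 4 → ℝ) (a b c d : ℝ) : Fin 7 → Prop :=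
  ![Equivalent v ![1, a, b, c] ∧ a + b + c + d = 0,
    Equivalent v ![1, a, b, c] ∧ a + b + c + d = 1,
    Equivalent v ![1, a, b, c] ∧ a + b + c + d = 2,
    Equivalent v ![1, a, b, (a + c) / 2] ∧ a + b + c + d = 0,
    Equivalent v ![1, a, b, (a + c) / 2] ∧ a + b + c + d = 2,
    Equivalent v ![1, a, b, (a + c + 1) / 2] ∧ a + b + c + d = 0,
    Equivalent v ![1, a, b, (a + c + 1) / 2] ∧ a + b + c + d = 2]

end

end KleinCF

/-!
The theorem is reduced to the classification of certain lattices with an automorphism of order four.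

A cyclic symmetry `G` that fixes a point of a sail has the eigenvalue `1`, because the origin does
not lie on a sail (`zero_notMem_closure_kleinPolyhedron`): along the edges of a cone, the sum of the
coordinates is bounded below on nonzero integer points. Conversely, every `G ∈ GL₄(ℤ)` permuting the
four lines is a symmetry (`PermutesBy.isSymmetry`), and if it has the eigenvalue `1`, it fixes a
nonzero integer point `z`; the segment from the origin to `z` crosses a sail in a fixed point
(`exists_smul_mem_sail`). So the question is which continued fractions admit a matrix `G` with
eigenvalue `1` that permutes the four lines cyclically.

Let `K` be the field of the eigenvalue of `l 0`. The coordinates of `(1, α, β, γ)` form a basis of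
`K` over `ℚ`. If `G` is such a matrix, let `u` be a primitive integer row vector with `u G = u`, and
let `w ∈ l 0` be normalized by `u w = 1`. The eigenvalue on the line `G (l 0)` lies in `K` too, which
gives an endomorphism `τ` of `K`; the vectors `G w` and `τ w` lie on the same line and agree under
`u`, so `G w = τ w`, and `τ` has order four. The coordinates of `w` generate a lattice `M` in `K`
that is stable under `τ` and contains `1` as a primitive vector (`isCyclicLattice_of_mulVec_eq`).

Such a lattice is built from three layers. The elements of `M` fixed by `τ` are the integers. The
elements fixed by `τ²` form a lattice `ℤ + ℤ e` with `e + τ e ∈ ℤ`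
(`IsCyclicLattice.exists_generator_fixed`). On the quotient by them, `τ² = -1`, so the quotient is a
module of rank one over the Gaussian integers, generated by the class of one element `f`
(`IsCyclicLattice.exists_generator_mod_fixed`). The integer `k` in `f + τ² f = k e + s` matters
modulo `2` only. If it is odd, `M` has the basis `1, f, τ f, τ² f`; if it is even, `M` has a basis
`1, ω, τ ω, e` with `ω = f + e` and `ω + τ² ω - 2 e ∈ ℤ`. Translations by integers and a change of
sign normalize the trace, which leaves the seven forms (`IsCyclicLattice.exists_frame`).

Conversely, in each normal form the conjugation acts on the basis by an integer matrix of order four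
with eigenvalue `1` (`frameMatrix`), and transporting it to `(1, α, β, γ)` gives `G`. The conjugates
of `ω` lie in `K`, which has degree four; so they generate `K`, which is therefore normal, and the
same holds for `α, β, γ` (`adjoin_eq_of_normalForm`).
-/

namespace KleinCF

open scoped Matrix


/-! ### The geometry of sails -/

theorem act_apply {n : ℕ} (G : Matrix.GeneralLinearGroup (Fin n) ℤ) (x : Fin n → ℝ) :
    act G x = (G : Matrix (Fin n) (Fin n) ℤ).map (Int.castRingHom ℝ) *ᵥ x := by
  simp [act]

theorem act_mul {n : ℕ} (G H : Matrix.GeneralLinearGroup (Fin n) ℤ) (x : Fin n → ℝ) :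
    act (G * H) x = act G (act H x) := by
  rw [act_apply, act_apply, act_apply, Matrix.mulVec_mulVec, ← Matrix.map_mul, Units.val_mul]

theorem act_one {n : ℕ} (x : Fin n → ℝ) :
    act (1 : Matrix.GeneralLinearGroup (Fin n) ℤ) x = x := by
  simp [act_apply, Matrix.map_one]

theorem act_inv_act {n : ℕ} (G : Matrix.GeneralLinearGroup (Fin n) ℤ) (x : Fin n → ℝ) :
    act G⁻¹ (act G x) = x := by
  rw [← act_mul, inv_mul_cancel, act_one]

theorem act_act_inv {n : ℕ} (G : Matrix.GeneralLinearGroup (Fin n) ℤ) (x : Fin n → ℝ) :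
    act G (act G⁻¹ x) = x := by
  rw [← act_mul, mul_inv_cancel, act_one]

theorem act_mem_integerPoints {n : ℕ} (G : Matrix.GeneralLinearGroup (Fin n) ℤ)
    {x : Fin n → ℝ} (hx : x ∈ integerPoints n) : act G x ∈ integerPoints n := by
  obtain ⟨z, rfl⟩ := hx
  refine ⟨(G : Matrix (Fin n) (Fin n) ℤ) *ᵥ z, ?_⟩
  ext i
  simp [act_apply, Matrix.mulVec, dotProduct]

/-- The homeomorphism of `ℝⁿ` given by `G ∈ GL_n(ℤ)`. -/
noncomputable def actHomeomorph {n : ℕ} (G : Matrix.GeneralLinearGroup (Fin n) ℤ) :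
    (Fin n → ℝ) ≃ₜ (Fin n → ℝ) where
  toFun := act G
  invFun := act G⁻¹
  left_inv := act_inv_act G
  right_inv := act_act_inv G
  continuous_toFun := (act G).continuous_of_finiteDimensional
  continuous_invFun := (act G⁻¹).continuous_of_finiteDimensional

theorem image_sail {n : ℕ} (G : Matrix.GeneralLinearGroup (Fin n) ℤ) (C : Set (Fin n → ℝ)) :
    act G '' sail C = sail (act G '' C) := by
  have hK : act G '' kleinPolyhedron C = kleinPolyhedron (act G '' C) := by
    unfold kleinPolyhedron
    rw [LinearMap.image_convexHull]
    congr 1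
    ext x
    constructor
    · rintro ⟨y, ⟨⟨hyC, hyZ⟩, hy0⟩, rfl⟩
      refine ⟨⟨⟨y, hyC, rfl⟩, act_mem_integerPoints G hyZ⟩, fun h => hy0 ?_⟩
      have := congrArg (act G⁻¹) (Set.mem_singleton_iff.1 h)
      simpa [act_inv_act] using this
    · rintro ⟨⟨⟨y, hyC, rfl⟩, hyZ⟩, hy0⟩
      refine ⟨y, ⟨⟨hyC, ?_⟩, fun h => hy0 ?_⟩, rfl⟩
      · simpa [act_inv_act] using act_mem_integerPoints G⁻¹ hyZ
      · rw [Set.mem_singleton_iff.1 h]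
        simp
  rw [sail, sail, ← hK]
  exact (actHomeomorph G).image_frontier _

theorem image_mem_cones {n : ℕ} {l : Fin n → Submodule ℝ (Fin n → ℝ)}
    {G : Matrix.GeneralLinearGroup (Fin n) ℤ} {s : Equiv.Perm (Fin n)} (h : PermutesBy l G s)
    {C : Set (Fin n → ℝ)} (hC : C ∈ cones l) : act G '' C ∈ cones l := by
  obtain ⟨v, hv, rfl⟩ := hC
  refine ⟨fun i => act G (v (s.symm i)), fun i => ?_, ?_⟩
  · have := h (s.symm i)
    rw [hv (s.symm i), Submodule.map_span, Set.image_singleton, s.apply_symm_apply] at this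
    exact this.symm
  · ext x
    constructor
    · rintro ⟨_, ⟨c, hc, rfl⟩, rfl⟩
      refine ⟨fun i => c (s.symm i), fun i => hc _, ?_⟩
      rw [map_sum, ← Equiv.sum_comp s.symm]
      simp
    · rintro ⟨c, hc, rfl⟩
      refine ⟨_, ⟨fun i => c (s i), fun i => hc _, rfl⟩, ?_⟩
      rw [map_sum, ← Equiv.sum_comp s.symm]
      simp

theorem PermutesBy.image_CF_subset {n : ℕ} {l : Fin n → Submodule ℝ (Fin n → ℝ)}
    {G : Matrix.GeneralLinearGroup (Fin n) ℤ} {s : Equiv.Perm (Fin n)} (h : PermutesBy l G s) :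
    act G '' CF l ⊆ CF l := by
  rintro _ ⟨x, hx, rfl⟩
  simp only [CF, Set.mem_iUnion] at hx ⊢
  obtain ⟨C, hC, hx⟩ := hx
  exact ⟨_, image_mem_cones h hC, image_sail G C ▸ ⟨x, hx, rfl⟩⟩

theorem PermutesBy.inv {n : ℕ} {l : Fin n → Submodule ℝ (Fin n → ℝ)}
    {G : Matrix.GeneralLinearGroup (Fin n) ℤ} {s : Equiv.Perm (Fin n)} (h : PermutesBy l G s) :
    PermutesBy l G⁻¹ s⁻¹ := by
  intro i
  have := h (s⁻¹ i)
  rw [show s (s⁻¹ i) = i from s.apply_symm_apply i] at this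
  rw [← this, ← Submodule.map_comp]
  convert Submodule.map_id _
  exact LinearMap.ext (act_inv_act G)

theorem PermutesBy.isSymmetry {n : ℕ} {l : Fin n → Submodule ℝ (Fin n → ℝ)}
    {G : Matrix.GeneralLinearGroup (Fin n) ℤ} {s : Equiv.Perm (Fin n)} (h : PermutesBy l G s) :
    IsSymmetry l G := by
  refine Set.Subset.antisymm h.image_CF_subset fun x hx => ?_
  exact ⟨act G⁻¹ x, h.inv.image_CF_subset ⟨x, hx, rfl⟩, act_act_inv G x⟩

/-- The eigenlines of a linear operator on `ℝⁿ` with `n` different eigenvalues are spanned by the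
vectors of a basis. -/
theorem exists_basis_eigenspace {n : ℕ} [NeZero n] (f : Module.End ℝ (Fin n → ℝ))
    {ev : Fin n → ℝ} (hinj : Function.Injective ev) (h : ∀ i, f.HasEigenvalue (ev i)) :
    ∃ x : Module.Basis (Fin n) ℝ (Fin n → ℝ),
      ∀ i, f.eigenspace (ev i) = Submodule.span ℝ {x i} := by
  choose x hx using fun i => (h i).exists_hasEigenvector
  have hli := Module.End.eigenvectors_linearIndependent' f ev hinj x hx
  refine ⟨basisOfLinearIndependentOfCardEqFinrank hli (by simp), fun i => ?_⟩
  set b := basisOfLinearIndependentOfCardEqFinrank hli (by simp) with hb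
  have hbx : ∀ j, b j = x j := fun j => by simp [hb]
  apply le_antisymm
  · intro z hz
    rw [Module.End.mem_eigenspace_iff] at hz
    have hsum : ∑ j, (b.repr z j * (ev j - ev i)) • b j = 0 := by
      have h1 : f z = ∑ j, (b.repr z j * ev j) • b j := by
        conv_lhs => rw [← b.sum_repr z, map_sum]
        refine Finset.sum_congr rfl fun j _ => ?_
        rw [map_smul, hbx, (hx j).apply_eq_smul, smul_smul]
      have h2 : ev i • z = ∑ j, (b.repr z j * ev i) • b j := by
        conv_lhs => rw [← b.sum_repr z, Finset.smul_sum]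
        refine Finset.sum_congr rfl fun j _ => ?_
        rw [smul_smul, mul_comm]
      simp only [mul_sub, sub_smul, Finset.sum_sub_distrib, ← h1, ← h2, hz, sub_self]
    have hz0 : ∀ j, j ≠ i → b.repr z j = 0 := by
      intro j hj
      have := Fintype.linearIndependent_iff.1 b.linearIndependent _ hsum j
      exact (mul_eq_zero.1 this).resolve_right (sub_ne_zero.2 fun h => hj (hinj h))
    rw [Submodule.mem_span_singleton]
    refine ⟨b.repr z i, ?_⟩
    conv_rhs => rw [← b.sum_repr z]
    refine (Fintype.sum_eq_single (f := fun j => b.repr z j • b j) i fun j hj => ?_).symm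
    simp only [hz0 j hj, zero_smul]
  · rw [Submodule.span_singleton_le_iff_mem, hbx]
    exact (hx i).1

theorem one_le_norm_of_mem_integerPoints {n : ℕ} {x : Fin n → ℝ} (hx : x ∈ integerPoints n)
    (h0 : x ≠ 0) : 1 ≤ ‖x‖ := by
  obtain ⟨z, rfl⟩ := hx
  obtain ⟨i, hi⟩ := Function.ne_iff.1 h0
  have hzi : z i ≠ 0 := by simpa using hi
  refine le_trans ?_ (norm_le_pi_norm (fun i => (z i : ℝ)) i)
  rw [Real.norm_eq_abs, ← Int.cast_abs]
  exact_mod_cast Int.one_le_abs hzi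

/-- The sum of the coordinates along the edges of the cone is bounded below by a positive
constant on the nonzero integer points of the cone, hence on its whole Klein polyhedron. -/
theorem zero_notMem_closure_kleinPolyhedron {n : ℕ} {l : Fin n → Submodule ℝ (Fin n → ℝ)}
    (x : Module.Basis (Fin n) ℝ (Fin n → ℝ)) (hx : ∀ i, l i = Submodule.span ℝ {x i})
    {C : Set (Fin n → ℝ)} (hC : C ∈ cones l) : 0 ∉ closure (kleinPolyhedron C) := by
  obtain ⟨v, hv, rfl⟩ := hC
  have hu : ∀ i, ∃ a : ℝˣ, a • x i = v i := fun i =>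
    Submodule.span_singleton_eq_span_singleton.1 ((hx i).symm.trans (hv i))
  choose a ha using hu
  let b := x.unitsSMul a
  have hb : ∀ i, b i = v i := fun i => by rw [x.unitsSMul_apply, ha]
  let f : (Fin n → ℝ) →ₗ[ℝ] ℝ := ∑ i, b.coord i
  have hf : ∀ c : Fin n → ℝ, f (∑ i, c i • v i) = ∑ i, c i := by
    intro c
    simp only [f, ← hb, LinearMap.sum_apply, Module.Basis.coord_apply, b.repr_sum_self]
  set V := 1 + ∑ i, ‖v i‖ with hV
  have hV0 : 0 < V := by positivity
  have hsub : closure (kleinPolyhedron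
      {x | ∃ c : Fin n → ℝ, (∀ i, 0 ≤ c i) ∧ x = ∑ i, c i • v i}) ⊆ {y | 1 / V ≤ f y} := by
    refine closure_minimal (convexHull_min ?_ (convex_halfSpace_ge f.isLinear _)) ?_
    · rintro _ ⟨⟨⟨c, hc, rfl⟩, hZ⟩, h0⟩
      have h1 := one_le_norm_of_mem_integerPoints hZ h0
      rw [Set.mem_ofPred_eq, hf, div_le_iff₀ hV0]
      refine h1.trans ((norm_sum_le _ _).trans ?_)
      rw [Finset.sum_mul]
      refine Finset.sum_le_sum fun i _ => ?_
      rw [norm_smul, Real.norm_of_nonneg (hc i)]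
      refine mul_le_mul_of_nonneg_left ?_ (hc i)
      have := Finset.single_le_sum (f := fun i => ‖v i‖) (fun i _ => norm_nonneg _)
        (Finset.mem_univ i)
      linarith
    · exact isClosed_le continuous_const f.continuous_of_finiteDimensional
  intro h0
  have := hsub h0
  rw [Set.mem_ofPred_eq, map_zero] at this
  exact absurd this (not_le.2 (by positivity))

/-- On its way from the origin to a nonzero integer point, a segment crosses a sail. -/
theorem exists_smul_mem_sail {n : ℕ} {l : Fin n → Submodule ℝ (Fin n → ℝ)}
    (x : Module.Basis (Fin n) ℝ (Fin n → ℝ)) (hx : ∀ i, l i = Submodule.span ℝ {x i})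
    {z : Fin n → ℝ} (hz : z ∈ integerPoints n) (hz0 : z ≠ 0) :
    ∃ C ∈ cones l, ∃ t : ℝ, t • z ∈ sail C := by
  -- the cone containing `z` is found by orienting each line according to the coordinate of `z`
  let a : Fin n → ℝˣ := fun i => if 0 ≤ x.repr z i then 1 else -1
  let C : Set (Fin n → ℝ) :=
    {y | ∃ c : Fin n → ℝ, (∀ i, 0 ≤ c i) ∧ y = ∑ i, c i • (a i • x i)}
  have hC : C ∈ cones l := by
    refine ⟨fun i => a i • x i, fun i => ?_, rfl⟩
    rw [hx i]
    exact Submodule.span_singleton_eq_span_singleton.2 ⟨a i, rfl⟩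
  have hzC : z ∈ C := by
    refine ⟨fun i => |x.repr z i|, fun i => abs_nonneg _, ?_⟩
    conv_lhs => rw [← x.sum_repr z]
    refine Finset.sum_congr rfl fun i _ => ?_
    by_cases h : 0 ≤ x.repr z i
    · simp [a, h, abs_of_nonneg h]
    · simp [a, h, abs_of_neg (not_le.1 h)]
  have hzK : z ∈ kleinPolyhedron C := subset_convexHull ℝ _ ⟨⟨hzC, hz⟩, hz0⟩
  have h0K : (0 : Fin n → ℝ) ∉ kleinPolyhedron C := fun h =>
    zero_notMem_closure_kleinPolyhedron x hx hC (subset_closure h)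
  by_contra hno
  push Not at hno
  have hfr : frontier ((fun t : ℝ => t • z) ⁻¹' kleinPolyhedron C) = ∅ := by
    rw [Set.eq_empty_iff_forall_notMem]
    intro t ht
    have hcont : Continuous fun t : ℝ => t • z := by fun_prop
    exact hno C hC t (hcont.frontier_preimage_subset _ ht)
  rcases frontier_eq_empty_iff.1 hfr with h | h
  · have : (1 : ℝ) ∈ (fun t : ℝ => t • z) ⁻¹' kleinPolyhedron C := by simpa using hzK
    rw [h] at this
    exact this
  · have : (0 : ℝ) ∈ (fun t : ℝ => t • z) ⁻¹' kleinPolyhedron C := h ▸ Set.mem_univ _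
    exact h0K (by simpa using this)

/-! ### Lattices with a cyclic automorphism of order four -/

/-- A lattice `M` in a real field, stable under an endomorphism `τ` with `τ⁴ = 1` and fixed
field `ℚ`, that contains `1` as a primitive vector. The existence of a common denominator replaces
finite generation. -/
structure IsCyclicLattice {K : IntermediateField ℚ ℝ} (τ : K →ₐ[ℚ] K) (M : AddSubgroup K) :
    Prop where
  one_mem : 1 ∈ M
  map_mem : ∀ x ∈ M, τ x ∈ M
  map_four : ∀ x, τ (τ (τ (τ x))) = x
  rat_of_fixed : ∀ x, τ x = x → ∃ q : ℚ, x = q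
  int_of_rat : ∀ q : ℚ, (q : K) ∈ M → ∃ n : ℤ, q = n
  denominator : ∃ N : ℤ, N ≠ 0 ∧ ∀ x ∈ M, IsIntegral ℤ (N • x)

namespace IsCyclicLattice

variable {K : IntermediateField ℚ ℝ} {τ : K →ₐ[ℚ] K} {M : AddSubgroup K}

theorem int_mem (h : IsCyclicLattice τ M) (n : ℤ) : (n : K) ∈ M := by
  simpa using M.zsmul_mem h.one_mem n

theorem int_mul_mem (n : ℤ) {x : K} (hx : x ∈ M) : (n : K) * x ∈ M := by
  simpa using M.zsmul_mem hx n

theorem int_of_fixed (h : IsCyclicLattice τ M) {x : K} (hx : x ∈ M) (hτ : τ x = x) :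
    ∃ n : ℤ, x = n := by
  obtain ⟨q, rfl⟩ := h.rat_of_fixed x hτ
  obtain ⟨n, rfl⟩ := h.int_of_rat q hx
  exact ⟨n, by simp⟩

theorem int_of_fixed_of_isIntegral (h : IsCyclicLattice τ M) {x : K} (hx : IsIntegral ℤ x)
    (hτ : τ x = x) : ∃ n : ℤ, x = n := by
  obtain ⟨q, rfl⟩ := h.rat_of_fixed x hτ
  have hq : IsIntegral ℤ q :=
    (isIntegral_algebraMap_iff (B := K) (algebraMap ℚ K).injective).1 (by simpa using hx)
  obtain ⟨n, rfl⟩ := IsIntegrallyClosed.isIntegral_iff.1 hq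
  exact ⟨n, by simp⟩

/-- The elements of the lattice that are fixed by `τ²` form a lattice with basis `1, e`: the image
of this lattice under `1 - τ` is a discrete subgroup of `ℝ`, because there the square of every
element is fixed by `τ`, hence rational with bounded denominator. -/
theorem exists_generator_fixed (h : IsCyclicLattice τ M) :
    ∃ e ∈ M, τ (τ e) = e ∧ ∀ m ∈ M, τ (τ m) = m → ∃ j n : ℤ, m = j * e + n := by
  obtain ⟨N, hN, hint⟩ := h.denominator
  let φ : K →+ ℝ := (algebraMap K ℝ).toAddMonoidHom.comp
    (AddMonoidHom.id K - (τ : K →+* K).toAddMonoidHom)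
  have hφ : ∀ x, φ x = ((x - τ x : K) : ℝ) := fun x => rfl
  let E : AddSubgroup K := M ⊓ (((τ : K →+* K).comp (τ : K →+* K)).toAddMonoidHom).eqLocus
    (AddMonoidHom.id K)
  have hE : ∀ x, x ∈ E ↔ x ∈ M ∧ τ (τ x) = x := fun x => Iff.rfl
  have hNpos : 0 < |(N : ℝ)| := by positivity
  have hiso : Disjoint ((E.map φ : AddSubgroup ℝ) : Set ℝ) (Set.Ioo 0 (1 / |(N : ℝ)|)) := by
    rw [Set.disjoint_left]
    rintro _ ⟨m, hm, rfl⟩ ⟨hpos, hlt⟩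
    obtain ⟨hmM, hm2⟩ := (hE m).1 hm
    rw [hφ] at hpos hlt
    have hi : IsIntegral ℤ (N • (m - τ m)) := hint _ (M.sub_mem hmM (h.map_mem _ hmM))
    obtain ⟨k, hk⟩ := h.int_of_fixed_of_isIntegral (hi.pow 2) (by
      simp only [map_pow, map_zsmul, map_sub, hm2]
      simp only [zsmul_eq_mul]
      ring)
    have hkR : ((N : ℝ) * ((m - τ m : K) : ℝ)) ^ 2 = k := by
      have := congrArg (fun x : K => (x : ℝ)) hk
      simpa using this
    have h1 : |(N : ℝ)| * ((m - τ m : K) : ℝ) < 1 := by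
      rw [lt_div_iff₀ hNpos] at hlt
      linarith
    have h2 : 0 < |(N : ℝ)| * ((m - τ m : K) : ℝ) := mul_pos hNpos hpos
    have h3 : (|(N : ℝ)| * ((m - τ m : K) : ℝ)) ^ 2 = k := by
      rw [← hkR, mul_pow, mul_pow, sq_abs]
    have h4 : (0 : ℝ) < k := by rw [← h3]; positivity
    have h5 : (k : ℝ) < 1 := by rw [← h3]; nlinarith
    norm_cast at h4 h5
    omega
  obtain ⟨b, hb⟩ := AddSubgroup.cyclic_of_isolated_zero (by positivity) hiso
  have hbm : b ∈ E.map φ := hb ▸ AddSubgroup.mem_closure_singleton_self b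
  obtain ⟨e, he, rfl⟩ := hbm
  refine ⟨e, he.1, he.2, fun m hm hm2 => ?_⟩
  have hmm : φ m ∈ E.map φ := ⟨m, ⟨hm, hm2⟩, rfl⟩
  rw [hb, AddSubgroup.mem_closure_singleton] at hmm
  obtain ⟨j, hj⟩ := hmm
  rw [← map_zsmul, hφ, hφ] at hj
  have hj' : j • e - τ (j • e) = m - τ m := Subtype.ext hj
  obtain ⟨n, hn⟩ := h.int_of_fixed (M.sub_mem hm (M.zsmul_mem he.1 j)) (by
    rw [map_sub]
    linear_combination hj')
  refine ⟨j, n, ?_⟩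
  rw [← hn, zsmul_eq_mul]
  ring

/-- Modulo the elements fixed by `τ²`, the lattice is generated by some `f` and `τ f`. On the image
of `1 - τ²` one has `τ² = -1`, so that this image embeds into `ℂ` by `y ↦ y - i τ y` as a module
over the Gaussian integers; the norm `y² + (τ y)²` has a bounded denominator, and division with
remainder by an element of least norm shows that the module is cyclic. -/
theorem exists_generator_mod_fixed (h : IsCyclicLattice τ M) :
    ∃ f ∈ M, ∀ m ∈ M, ∃ a b : ℤ,
      τ (τ (m - a * f - b * τ f)) = m - a * f - b * τ f := by
  obtain ⟨N, hN, hint⟩ := h.denominator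
  have hg : ∀ m : M, ∃ k : ℕ,
      (N : ℝ) ^ 2 * (((m - τ (τ m) : K) : ℝ) ^ 2 + ((τ (m - τ (τ m)) : K) : ℝ) ^ 2) = k := by
    rintro ⟨m, hm⟩
    have hy : m - τ (τ m) ∈ M := M.sub_mem hm (h.map_mem _ (h.map_mem _ hm))
    have hi : IsIntegral ℤ ((N • (m - τ (τ m))) ^ 2 + (N • τ (m - τ (τ m))) ^ 2) :=
      ((hint _ hy).pow 2).add ((hint _ (h.map_mem _ hy)).pow 2)
    obtain ⟨k, hk⟩ := h.int_of_fixed_of_isIntegral hi (by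
      simp only [map_pow, map_zsmul, map_sub, map_add, h.map_four]
      simp only [zsmul_eq_mul]
      ring)
    have hkR : (N : ℝ) ^ 2 * (((m - τ (τ m) : K) : ℝ) ^ 2 + ((τ (m - τ (τ m)) : K) : ℝ) ^ 2)
        = k := by
      have := congrArg (fun x : K => (x : ℝ)) hk
      simp only [zsmul_eq_mul] at this
      push_cast at this ⊢
      linear_combination this
    have hk0 : 0 ≤ k := by
      have : (0 : ℝ) ≤ k := by rw [← hkR]; positivity
      exact_mod_cast this
    lift k to ℕ using hk0
    exact ⟨k, by simpa using hkR⟩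
  choose g hg using hg
  by_cases hall : ∀ m ∈ M, τ (τ m) = m
  · exact ⟨0, M.zero_mem, fun m hm => ⟨0, 0, by simpa using hall m hm⟩⟩
  push Not at hall
  obtain ⟨m₀, hm₀, hne₀⟩ := hall
  obtain ⟨f, hf, hmin⟩ := exists_minimalFor_of_wellFoundedLT
    (fun m : M => τ (τ (m : K)) ≠ m) g ⟨⟨m₀, hm₀⟩, hne₀⟩
  refine ⟨f, f.2, fun m hm => ?_⟩
  set p : ℝ := ((f - τ (τ f) : K) : ℝ) with hp
  set p' : ℝ := ((τ (f - τ (τ f)) : K) : ℝ) with hp'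
  set y : ℝ := ((m - τ (τ m) : K) : ℝ) with hy
  set y' : ℝ := ((τ (m - τ (τ m)) : K) : ℝ) with hy'
  have hp0 : p ≠ 0 := by
    intro h0
    refine hf (sub_eq_zero.1 (Subtype.ext ?_)).symm
    rw [← hp, h0]
    rfl
  have hnorm : 0 < p ^ 2 + p' ^ 2 := by positivity
  set a₀ := (y * p + y' * p') / (p ^ 2 + p' ^ 2) with ha₀
  set b₀ := (y * p' - y' * p) / (p ^ 2 + p' ^ 2) with hb₀
  refine ⟨round a₀, round b₀, ?_⟩
  by_contra hne
  let r : M := ⟨m - round a₀ * f - round b₀ * τ f, M.sub_mem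
    (M.sub_mem hm (int_mul_mem _ f.2)) (int_mul_mem _ (h.map_mem _ f.2))⟩
  have hle : g f ≤ g r := by
    by_contra hlt
    exact hlt (hmin (j := r) hne (not_le.1 hlt).le)
  have hr : ((r - τ (τ r) : K) : ℝ) = y - round a₀ * p - round b₀ * p' := by
    simp only [r, hy, hp, hp', map_sub, map_mul, map_intCast]
    push_cast
    ring
  have hr' : ((τ (r - τ (τ r)) : K) : ℝ) = y' - round a₀ * p' + round b₀ * p := by
    simp only [r, hy', hp, hp', map_sub, map_mul, map_intCast, h.map_four]
    push_cast
    ring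
  have hgr := hg r
  have hgf := hg f
  rw [hr, hr'] at hgr
  rw [← hp, ← hp'] at hgf
  have hA : |a₀ - round a₀| ≤ 1 / 2 := abs_sub_round a₀
  have hB : |b₀ - round b₀| ≤ 1 / 2 := abs_sub_round b₀
  have hid : (y - round a₀ * p - round b₀ * p') ^ 2 + (y' - round a₀ * p' + round b₀ * p) ^ 2
      = ((a₀ - round a₀) ^ 2 + (b₀ - round b₀) ^ 2) * (p ^ 2 + p' ^ 2) := by
    have e1 : y = a₀ * p + b₀ * p' := by
      rw [ha₀, hb₀]; field_simp; ring
    have e2 : y' = a₀ * p' - b₀ * p := by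
      rw [ha₀, hb₀]; field_simp; ring
    rw [e1, e2]
    ring
  have hA2 : (a₀ - round a₀) ^ 2 ≤ 1 / 4 := by
    rw [← sq_abs]; nlinarith [abs_nonneg (a₀ - round a₀)]
  have hB2 : (b₀ - round b₀) ^ 2 ≤ 1 / 4 := by
    rw [← sq_abs]; nlinarith [abs_nonneg (b₀ - round b₀)]
  have hN2 : 0 < (N : ℝ) ^ 2 := by positivity
  have hle' : (g f : ℝ) ≤ g r := by exact_mod_cast hle
  rw [← hgr, ← hgf, hid] at hle'
  have := le_of_mul_le_mul_left hle' hN2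
  nlinarith

end IsCyclicLattice

/-! ### The seven normal forms -/

/-- The vector attached to the numbers `a = ω`, `b = ω'`, `c = ω''` in the `k`-th of the seven
normal forms. -/
def frame {F : Type*} [Field F] (a b c : F) : Fin 7 → Fin 4 → F :=
  ![![1, a, b, c], ![1, a, b, c], ![1, a, b, c],
    ![1, a, b, (a + c) / 2], ![1, a, b, (a + c) / 2],
    ![1, a, b, (a + c + 1) / 2], ![1, a, b, (a + c + 1) / 2]]

/-- The trace of `ω` prescribed by the `k`-th of the seven normal forms. -/
def frameTrace : Fin 7 → ℤ := ![0, 1, 2, 0, 2, 0, 2]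

theorem normalForm_iff (v : Fin 4 → ℝ) (a b c d : ℝ) (k : Fin 7) :
    NormalForm v a b c d k ↔ Equivalent v (frame a b c k) ∧ a + b + c + d = frameTrace k := by
  fin_cases k <;> simp [NormalForm, frame, frameTrace]

theorem map_frame {F L : Type*} [Field F] [Field L] (f : F →+* L) (a b c : F) (k : Fin 7) :
    f ∘ frame a b c k = frame (f a) (f b) (f c) k := by
  ext i
  fin_cases k <;> fin_cases i <;> simp [frame, map_ofNat]

theorem frame_zero {F : Type*} [Field F] (a b c : F) (k : Fin 7) : frame a b c k 0 = 1 := by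
  fin_cases k <;> simp [frame]

theorem frame_one {F : Type*} [Field F] (a b c : F) (k : Fin 7) : frame a b c k 1 = a := by
  fin_cases k <;> simp [frame]

theorem frame_two {F : Type*} [Field F] (a b c : F) (k : Fin 7) : frame a b c k 2 = b := by
  fin_cases k <;> simp [frame]

namespace IsCyclicLattice

variable {K : IntermediateField ℚ ℝ} {τ : K →ₐ[ℚ] K} {M : AddSubgroup K}

/-- If the element `f` generating `M` modulo the elements fixed by `τ²` satisfies
`f + τ² f = e + s`, then `M` is generated by `1` and the conjugates of `f`, and a translation by an
integer, possibly after a change of sign, brings the trace of `f` to `0`, `1` or `2`. -/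
theorem exists_frame_of_odd (h : IsCyclicLattice τ M) {e f : K} (hf : f ∈ M) {s : ℤ}
    (hs : f + τ (τ f) = e + s)
    (hgen : ∀ m ∈ M, ∃ a b j n : ℤ, m = a * f + b * τ f + j * e + n) :
    ∃ (ω : K) (k : Fin 7), (ω + τ ω + τ (τ ω) + τ (τ (τ ω)) = (frameTrace k : ℤ)) ∧
      (∀ i, frame ω (τ ω) (τ (τ ω)) k i ∈ M) ∧
      ∀ m ∈ M, ∃ c : Fin 4 → ℤ, m = ∑ i, (c i : K) * frame ω (τ ω) (τ (τ ω)) k i := by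
  obtain ⟨T, hT⟩ := h.int_of_fixed (x := f + τ f + τ (τ f) + τ (τ (τ f)))
    (M.add_mem (M.add_mem (M.add_mem hf (h.map_mem _ hf)) (h.map_mem _ (h.map_mem _ hf)))
      (h.map_mem _ (h.map_mem _ (h.map_mem _ hf)))) (by
      simp only [map_add, h.map_four]
      ring)
  -- `ω = u f + t` with a sign `u`
  have key : ∀ (u t : ℤ) (k : Fin 7), u * u = 1 → u * T + 4 * t = frameTrace k →
      (∀ a b c : K, frame a b c k = ![1, a, b, c]) →
      ∃ (ω : K) (k : Fin 7), (ω + τ ω + τ (τ ω) + τ (τ (τ ω)) = (frameTrace k : ℤ)) ∧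
      (∀ i, frame ω (τ ω) (τ (τ ω)) k i ∈ M) ∧
      ∀ m ∈ M, ∃ c : Fin 4 → ℤ, m = ∑ i, (c i : K) * frame ω (τ ω) (τ (τ ω)) k i := by
    intro u t k hu htr hfr
    have hω : (u : K) * f + t ∈ M := M.add_mem (int_mul_mem _ hf) (h.int_mem _)
    refine ⟨u * f + t, k, ?_, ?_, ?_⟩
    · rw [← htr]
      simp only [map_add, map_mul, map_intCast]
      push_cast
      linear_combination (u : K) * hT
    · rw [hfr]
      intro i
      fin_cases i
      · exact h.one_mem
      · exact hω
      · exact h.map_mem _ hω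
      · exact h.map_mem _ (h.map_mem _ hω)
    · intro m hm
      obtain ⟨a, b, j, n, rfl⟩ := hgen m hm
      refine ⟨![n - j * s - u * t * (a + b + 2 * j), u * (a + j), u * b, u * j], ?_⟩
      have hu' : (u : K) * u = 1 := by exact_mod_cast hu
      rw [hfr, Fin.sum_univ_four]
      simp only [map_add, map_mul, map_intCast, Matrix.cons_val]
      push_cast
      linear_combination -(j : K) * hs - (a * f + b * τ f + j * f + j * τ (τ f)) * hu'
  have h4 : T % 4 = 0 ∨ T % 4 = 1 ∨ T % 4 = 2 ∨ T % 4 = 3 := by omega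
  rcases h4 with h4 | h4 | h4 | h4
  · exact key 1 (-(T / 4)) 0 (by norm_num) (by simp only [frameTrace, Matrix.cons_val]; omega)
      (fun _ _ _ => rfl)
  · exact key 1 (-(T / 4)) 1 (by norm_num) (by simp only [frameTrace, Matrix.cons_val]; omega)
      (fun _ _ _ => rfl)
  · exact key 1 (-(T / 4)) 2 (by norm_num) (by simp only [frameTrace, Matrix.cons_val]; omega)
      (fun _ _ _ => rfl)
  · exact key (-1) (T / 4 + 1) 1 (by norm_num)
      (by simp only [frameTrace, Matrix.cons_val]; omega) (fun _ _ _ => rfl)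

/-- If `f + τ² f` is an integer `s`, and `e + τ e = t`, then `ω = f + e` has
`ω + τ² ω = s + 2 e`, and `M` is generated by `1`, `ω`, `τ ω` and `e`. The parities of `s` and `t`
distinguish four cases, in each of which a translation of `ω` by an integer leads to the normal
form. -/
theorem exists_frame_of_even (h : IsCyclicLattice τ M) {e f : K} (he : e ∈ M) (hf : f ∈ M)
    (he2 : τ (τ e) = e) {s : ℤ} (hs : f + τ (τ f) = s)
    (hgen : ∀ m ∈ M, ∃ a b j n : ℤ, m = a * f + b * τ f + j * e + n) :
    ∃ (ω : K) (k : Fin 7), (ω + τ ω + τ (τ ω) + τ (τ (τ ω)) = (frameTrace k : ℤ)) ∧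
      (∀ i, frame ω (τ ω) (τ (τ ω)) k i ∈ M) ∧
      ∀ m ∈ M, ∃ c : Fin 4 → ℤ, m = ∑ i, (c i : K) * frame ω (τ ω) (τ (τ ω)) k i := by
  obtain ⟨t, ht⟩ := h.int_of_fixed (x := e + τ e) (M.add_mem he (h.map_mem _ he)) (by
      simp only [map_add, he2]
      ring)
  have hs' : τ f + τ (τ (τ f)) = s := by
    have := congrArg τ hs
    simpa using this
  have hτe : τ e = t - e := by linear_combination ht
  -- `ω = f + e + r`, and the last element of the basis is `e + w + r`
  have key : ∀ (r u w : ℤ) (k : Fin 7), 2 * s + 2 * t + 4 * r = frameTrace k → s + u = 2 * w →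
      (∀ a b c : K, frame a b c k = ![1, a, b, (a + c + u) / 2]) →
      ∃ (ω : K) (k : Fin 7), (ω + τ ω + τ (τ ω) + τ (τ (τ ω)) = (frameTrace k : ℤ)) ∧
      (∀ i, frame ω (τ ω) (τ (τ ω)) k i ∈ M) ∧
      ∀ m ∈ M, ∃ c : Fin 4 → ℤ, m = ∑ i, (c i : K) * frame ω (τ ω) (τ (τ ω)) k i := by
    intro r u w k htr huw hfr
    have hω : f + e + (r : K) ∈ M := M.add_mem (M.add_mem hf he) (h.int_mem _)
    have huw' : (s : K) + u = 2 * w := by exact_mod_cast huw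
    have hlast : (f + e + (r : K) + τ (τ (f + e + (r : K))) + u) / 2 = e + w + r := by
      simp only [map_add, map_intCast, he2]
      linear_combination (hs + huw') / 2
    refine ⟨f + e + r, k, ?_, ?_, ?_⟩
    · rw [← htr]
      simp only [map_add, map_intCast, he2]
      push_cast
      linear_combination hs + hs' + 2 * ht
    · rw [hfr, hlast]
      intro i
      fin_cases i
      · exact h.one_mem
      · exact hω
      · exact h.map_mem _ hω
      · exact M.add_mem (M.add_mem he (h.int_mem _)) (h.int_mem _)
    · intro m hm
      obtain ⟨a, b, j, n, rfl⟩ := hgen m hm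
      refine ⟨![n - a * r - b * t - b * r - (j - a + b) * (w + r), a, b, j - a + b], ?_⟩
      rw [hfr, hlast, Fin.sum_univ_four]
      simp only [map_add, map_intCast, Matrix.cons_val, hτe]
      push_cast
      ring
  have h0 : ∀ k : Fin 7, (∀ a b c : K, frame a b c k = ![1, a, b, (a + c) / 2]) →
      ∀ a b c : K, frame a b c k = ![1, a, b, (a + c + (0 : ℤ)) / 2] := by
    intro k hk a b c
    simpa using hk a b c
  have h1 : ∀ k : Fin 7, (∀ a b c : K, frame a b c k = ![1, a, b, (a + c + 1) / 2]) →
      ∀ a b c : K, frame a b c k = ![1, a, b, (a + c + (1 : ℤ)) / 2] := by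
    intro k hk a b c
    simpa using hk a b c
  rcases Int.emod_two_eq_zero_or_one s with hs2 | hs2 <;>
    rcases Int.emod_two_eq_zero_or_one t with ht2 | ht2
  · exact key (-(s / 2) - t / 2) 0 (s / 2) 3
      (by simp only [frameTrace, Matrix.cons_val]; omega) (by omega) (h0 _ fun _ _ _ => rfl)
  · exact key (-(s / 2) - t / 2) 0 (s / 2) 4
      (by simp only [frameTrace, Matrix.cons_val]; omega) (by omega) (h0 _ fun _ _ _ => rfl)
  · exact key (1 - (s + 1) / 2 - t / 2) 1 ((s + 1) / 2) 6
      (by simp only [frameTrace, Matrix.cons_val]; omega) (by omega) (h1 _ fun _ _ _ => rfl)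
  · exact key (-((s + 1) / 2) - t / 2) 1 ((s + 1) / 2) 5
      (by simp only [frameTrace, Matrix.cons_val]; omega) (by omega) (h1 _ fun _ _ _ => rfl)

/-- Classification of the cyclic lattices: such a lattice has a basis in one of the seven normal
forms. With `e` and `f` the generators of the two layers, `f + τ² f = k e + s` for integers `k` and
`s`, and replacing `f` by `f - j e` changes `k` by `2 j`; the two classes of `k` modulo `2` are
treated separately. -/
theorem exists_frame (h : IsCyclicLattice τ M) :
    ∃ (ω : K) (k : Fin 7), (ω + τ ω + τ (τ ω) + τ (τ (τ ω)) = (frameTrace k : ℤ)) ∧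
      (∀ i, frame ω (τ ω) (τ (τ ω)) k i ∈ M) ∧
      ∀ m ∈ M, ∃ c : Fin 4 → ℤ, m = ∑ i, (c i : K) * frame ω (τ ω) (τ (τ ω)) k i := by
  obtain ⟨e, he, he2, hgenE⟩ := h.exists_generator_fixed
  obtain ⟨f, hf, hgenF⟩ := h.exists_generator_mod_fixed
  obtain ⟨t, ht⟩ := h.int_of_fixed (x := e + τ e) (M.add_mem he (h.map_mem _ he)) (by
      simp only [map_add, he2]
      ring)
  obtain ⟨k, s, hk⟩ := hgenE (f + τ (τ f)) (M.add_mem hf (h.map_mem _ (h.map_mem _ hf))) (by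
      simp only [map_add, h.map_four]
      ring)
  have hgen : ∀ i : ℤ, ∀ m ∈ M, ∃ a b j n : ℤ,
      m = a * (f - i * e) + b * τ (f - i * e) + j * e + n := by
    intro i m hm
    obtain ⟨a, b, hab⟩ := hgenF m hm
    obtain ⟨j, n, hjn⟩ := hgenE (m - a * f - b * τ f) (M.sub_mem
      (M.sub_mem hm (int_mul_mem _ hf)) (int_mul_mem _ (h.map_mem _ hf))) hab
    refine ⟨a, b, j + a * i - b * i, n + b * i * t, ?_⟩
    simp only [map_sub, map_mul, map_intCast]
    push_cast
    linear_combination hjn + (b : K) * i * ht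
  have hfi : ∀ i : ℤ, f - i * e ∈ M := fun i => M.sub_mem hf (int_mul_mem _ he)
  obtain ⟨i, hi | hi⟩ := Int.even_or_odd' k
  · refine h.exists_frame_of_even he (hfi i) he2 (s := s) ?_ (hgen i)
    simp only [map_sub, map_mul, map_intCast, he2]
    rw [hi] at hk
    push_cast at hk
    linear_combination hk
  · refine h.exists_frame_of_odd (hfi i) (e := e) (s := s) ?_ (hgen i)
    simp only [map_sub, map_mul, map_intCast, he2]
    rw [hi] at hk
    push_cast at hk
    linear_combination hk

end IsCyclicLattice

/-! ### Eigenvectors over the field generated by an eigenvalue -/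

open IntermediateField

theorem comp_intMatrix_mulVec {n : ℕ} {R S : Type*} [CommRing R] [CommRing S] (f : R →+* S)
    (G : Matrix (Fin n) (Fin n) ℤ) (y : Fin n → R) :
    f ∘ (G.map (Int.castRingHom R) *ᵥ y) = G.map (Int.castRingHom S) *ᵥ (f ∘ y) := by
  ext i
  rw [Function.comp_apply, RingHom.map_mulVec]
  congr 2
  ext i j
  simp

theorem act_comp_algebraMap {n : ℕ} {K : IntermediateField ℚ ℝ}
    (G : Matrix.GeneralLinearGroup (Fin n) ℤ) (y : Fin n → K) :
    act G (algebraMap K ℝ ∘ y) =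
      algebraMap K ℝ ∘ ((G : Matrix (Fin n) (Fin n) ℤ).map (Int.castRingHom K) *ᵥ y) := by
  rw [act_apply, comp_intMatrix_mulVec]

theorem minpoly_eigenvalue {n : ℕ} {A : Matrix.GeneralLinearGroup (Fin n) ℤ}
    (hA : IsHyperbolic A) {lam : ℝ} (hlam : Module.End.HasEigenvalue (act A) lam) :
    minpoly ℚ lam = (A : Matrix (Fin n) (Fin n) ℤ).charpoly.map (Int.castRingHom ℚ) := by
  refine (minpoly.eq_of_irreducible_of_monic hA.1 ?_ ((Matrix.charpoly_monic _).map _)).symm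
  rw [Module.End.hasEigenvalue_iff_isRoot_charpoly, act, Matrix.charpoly_toLin',
    Matrix.charpoly_map, Polynomial.IsRoot, Polynomial.eval_map] at hlam
  rw [Polynomial.aeval_def, Polynomial.eval₂_map]
  rwa [RingHom.ext_int ((algebraMap ℚ ℝ).comp (Int.castRingHom ℚ)) (Int.castRingHom ℝ)]

theorem isIntegral_eigenvalue {n : ℕ} {A : Matrix.GeneralLinearGroup (Fin n) ℤ}
    (hA : IsHyperbolic A) {lam : ℝ} (hlam : Module.End.HasEigenvalue (act A) lam) :
    IsIntegral ℚ lam := by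
  rw [← minpoly.ne_zero_iff, minpoly_eigenvalue hA hlam]
  exact ((Matrix.charpoly_monic _).map _).ne_zero

theorem finrank_adjoin_eigenvalue {n : ℕ} {A : Matrix.GeneralLinearGroup (Fin n) ℤ}
    (hA : IsHyperbolic A) {lam : ℝ} (hlam : Module.End.HasEigenvalue (act A) lam) :
    Module.finrank ℚ ℚ⟮lam⟯ = n := by
  rw [adjoin.finrank (isIntegral_eigenvalue hA hlam), minpoly_eigenvalue hA hlam,
    (Matrix.charpoly_monic _).natDegree_map, Matrix.charpoly_natDegree_eq_dim, Fintype.card_fin]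

/-- The eigenvector normalized by its first coordinate has its coordinates in the field generated
by the eigenvalue. -/
theorem exists_comp_algebraMap_eq {n : ℕ} [NeZero n]
    {A : Matrix.GeneralLinearGroup (Fin n) ℤ} {lam : ℝ}
    (hlam : Module.End.HasEigenvalue (act A) lam) {v : Fin n → ℝ}
    (hv : Module.End.eigenspace (act A) lam = Submodule.span ℝ {v}) (hv0 : v 0 = 1) :
    ∃ y : Fin n → ℚ⟮lam⟯, algebraMap ℚ⟮lam⟯ ℝ ∘ y = v := by
  set g : ℚ⟮lam⟯ := AdjoinSimple.gen ℚ lam with hg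
  have hg' : algebraMap ℚ⟮lam⟯ ℝ g = lam := AdjoinSimple.algebraMap_gen ℚ lam
  set AK := (A : Matrix (Fin n) (Fin n) ℤ).map (Int.castRingHom ℚ⟮lam⟯)
  have hdet : (Matrix.scalar (Fin n) g - AK).det = 0 := by
    rw [← Matrix.eval_charpoly]
    apply (algebraMap ℚ⟮lam⟯ ℝ).injective
    rw [map_zero, ← Polynomial.eval_map_apply, hg', ← Matrix.charpoly_map, Matrix.map_map]
    rw [Module.End.hasEigenvalue_iff_isRoot_charpoly, act, Matrix.charpoly_toLin'] at hlam
    have hmap : (A : Matrix (Fin n) (Fin n) ℤ).map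
        (algebraMap ℚ⟮lam⟯ ℝ ∘ Int.castRingHom ℚ⟮lam⟯) =
        (A : Matrix (Fin n) (Fin n) ℤ).map (Int.castRingHom ℝ) := by
      ext i j
      simp
    rw [hmap]
    exact hlam
  obtain ⟨z, hz0, hz⟩ := Matrix.exists_mulVec_eq_zero_iff.2 hdet
  have hz' : AK *ᵥ z = g • z := by
    rw [Matrix.sub_mulVec, sub_eq_zero] at hz
    rw [← hz]
    ext i
    simp [Matrix.scalar_apply, Matrix.mulVec_diagonal]
  have hmem : algebraMap ℚ⟮lam⟯ ℝ ∘ z ∈ Module.End.eigenspace (act A) lam := by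
    rw [Module.End.mem_eigenspace_iff, act_comp_algebraMap, hz']
    ext i
    rw [Function.comp_apply, Pi.smul_apply, smul_eq_mul, map_mul, hg']
    rfl
  rw [hv, Submodule.mem_span_singleton] at hmem
  obtain ⟨c, hc⟩ := hmem
  have hc0 : c = algebraMap ℚ⟮lam⟯ ℝ (z 0) := by
    have := congrFun hc 0
    simpa [hv0] using this
  have hcne : c ≠ 0 := by
    rintro rfl
    refine hz0 (funext fun i => (algebraMap ℚ⟮lam⟯ ℝ).injective ?_)
    have := congrFun hc i
    simpa using this.symm
  refine ⟨fun i => (z 0)⁻¹ * z i, funext fun i => ?_⟩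
  have := congrFun hc i
  simp only [Pi.smul_apply, smul_eq_mul, Function.comp_apply] at this
  rw [Function.comp_apply, map_mul, map_inv₀, ← hc0, ← this, inv_mul_cancel_left₀ hcne]

/-- The coordinates of a normalized eigenvector span a subspace that contains `1` and is stable
under multiplication by the eigenvalue; hence they form a basis of the field. -/
theorem linearIndependent_eigenvector {n : ℕ} [NeZero n]
    {A : Matrix.GeneralLinearGroup (Fin n) ℤ} (hA : IsHyperbolic A) {lam : ℝ}
    (hlam : Module.End.HasEigenvalue (act A) lam) {y : Fin n → ℚ⟮lam⟯}
    (hy : algebraMap ℚ⟮lam⟯ ℝ ∘ y ∈ Module.End.eigenspace (act A) lam) (hy0 : y 0 = 1) :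
    LinearIndependent ℚ y := by
  have hint := isIntegral_eigenvalue hA hlam
  set g : ℚ⟮lam⟯ := AdjoinSimple.gen ℚ lam with hg
  have hg' : algebraMap ℚ⟮lam⟯ ℝ g = lam := AdjoinSimple.algebraMap_gen ℚ lam
  have hmul : ∀ i, g * y i = ∑ j, ((A : Matrix (Fin n) (Fin n) ℤ) i j : ℚ) • y j := by
    intro i
    apply (algebraMap ℚ⟮lam⟯ ℝ).injective
    rw [Module.End.mem_eigenspace_iff] at hy
    have := congrFun hy i
    rw [act_comp_algebraMap] at this
    simp only [Function.comp_apply, Pi.smul_apply, smul_eq_mul] at this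
    rw [map_mul, hg', ← this]
    simp [Matrix.mulVec, dotProduct, Algebra.smul_def]
  let W : Submodule ℚ ℚ⟮lam⟯ := Submodule.span ℚ (Set.range y)
  have hgW : ∀ x ∈ W, g * x ∈ W := by
    intro x hx
    induction hx using Submodule.span_induction with
    | mem x hx =>
      obtain ⟨i, rfl⟩ := hx
      rw [hmul]
      exact Submodule.sum_mem _ fun j _ => Submodule.smul_mem _ _
        (Submodule.subset_span ⟨j, rfl⟩)
    | zero => rw [mul_zero]; exact W.zero_mem
    | add x x' _ _ hx hx' => rw [mul_add]; exact W.add_mem hx hx'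
    | smul c x _ hx => rw [mul_smul_comm]; exact W.smul_mem c hx
  have hpow : ∀ k : ℕ, g ^ k ∈ W := by
    intro k
    induction k with
    | zero => rw [pow_zero, ← hy0]; exact Submodule.subset_span ⟨0, rfl⟩
    | succ k ih => rw [pow_succ']; exact hgW _ ih
  refine linearIndependent_of_top_le_span_of_card_eq_finrank ?_
    (by rw [finrank_adjoin_eigenvalue hA hlam, Fintype.card_fin])
  rw [← (adjoin.powerBasis hint).basis.span_eq, Submodule.span_le]
  rintro _ ⟨i, rfl⟩
  rw [PowerBasis.basis_eq_pow, adjoin.powerBasis_gen]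
  exact hpow _

/-- There are no eigenvalues besides `n` different ones. -/
theorem exists_eq_of_hasEigenvalue {n : ℕ} (f : Module.End ℝ (Fin n → ℝ))
    {ev : Fin n → ℝ} (hinj : Function.Injective ev) (h : ∀ i, f.HasEigenvalue (ev i)) {mu : ℝ}
    (hmu : f.HasEigenvalue mu) : ∃ i, ev i = mu := by
  by_contra! hne
  let ev' : Option (Fin n) → ℝ := fun o => o.elim mu ev
  have hinj' : Function.Injective ev' := by
    rintro (_ | i) (_ | j) hij
    · rfl
    · exact absurd hij.symm (hne j)
    · exact absurd hij (hne i)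
    · exact congrArg some (hinj hij)
  have h' : ∀ o, f.HasEigenvalue (ev' o) := by
    rintro (_ | i)
    exacts [hmu, h i]
  choose x hx using fun o => (h' o).exists_hasEigenvector
  have := (Module.End.eigenvectors_linearIndependent' f ev' hinj' x hx).fintype_card_le_finrank
  simp at this

/-- The first of four numbers, all conjugates of it, generates the field they generate inside any
field of degree `4`. -/
theorem adjoin_range_eq {K : IntermediateField ℚ ℝ} (hK : Module.finrank ℚ K = 4)
    {w : Fin 4 → ℝ} (hw : ∀ i, w i ∈ K)
    (hmin : (minpoly ℚ (w 0)).map (algebraMap ℚ ℝ) =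
      ∏ i, (Polynomial.X - Polynomial.C (w i))) :
    IntermediateField.adjoin ℚ (Set.range w) = K := by
  have hfin : FiniteDimensional ℚ K := FiniteDimensional.of_finrank_pos (by omega)
  have hint : IsIntegral ℚ (w 0) := by
    have := Algebra.IsIntegral.isIntegral (R := ℚ) (⟨w 0, hw 0⟩ : K)
    exact this.map K.val
  have hle : IntermediateField.adjoin ℚ (Set.range w) ≤ K := by
    rw [adjoin_le_iff]
    rintro _ ⟨i, rfl⟩
    exact hw i
  refine le_antisymm hle ?_
  have h0 : ℚ⟮w 0⟯ = K := by
    refine eq_of_le_of_finrank_eq (adjoin_simple_le_iff.2 (hw 0)) ?_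
    rw [adjoin.finrank hint, hK, ← Polynomial.natDegree_map (algebraMap ℚ ℝ), hmin,
      Polynomial.natDegree_finsetProd_X_sub_C_eq_card, Finset.card_univ, Fintype.card_fin]
  conv_lhs => rw [← h0]
  exact adjoin_simple_le_iff.2 (subset_adjoin ℚ _ ⟨0, rfl⟩)

/-- The fixed field of an endomorphism of order `4` of a field of degree `4` is `ℚ`. -/
theorem rat_of_fixed {K : IntermediateField ℚ ℝ} (hK : Module.finrank ℚ K = 4) {τ : K →ₐ[ℚ] K}
    (h4 : ∀ x, τ (τ (τ (τ x))) = x) {x₀ : K} (h2 : τ (τ x₀) ≠ x₀) {x : K} (hx : τ x = x) :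
    ∃ q : ℚ, x = q := by
  have hfin : FiniteDimensional ℚ K := FiniteDimensional.of_finrank_pos (by omega)
  let σ : K ≃ₐ[ℚ] K := AlgEquiv.ofBijective τ (Algebra.IsAlgebraic.algHom_bijective τ)
  have hσ : ∀ x, σ x = τ x := fun x => rfl
  have hord : orderOf σ = 2 ^ (1 + 1) := by
    refine orderOf_eq_prime_pow (fun h => h2 ?_) ?_
    · have := congrArg (fun f : K ≃ₐ[ℚ] K => f x₀) h
      simpa [pow_succ, hσ] using this
    · ext1 x
      simp [pow_succ, hσ, h4]
  have hcard := finrank_fixedField_eq_card (Subgroup.zpowers σ)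
  rw [Nat.card_zpowers, hord] at hcard
  have hmul := Module.finrank_mul_finrank ℚ (fixedField (Subgroup.zpowers σ)) K
  rw [hcard, hK] at hmul
  have hone : Module.finrank ℚ (fixedField (Subgroup.zpowers σ)) = 1 := by omega
  have hmem : x ∈ fixedField (Subgroup.zpowers σ) := by
    rw [mem_fixedField_iff]
    intro f hf
    have hle : Subgroup.zpowers σ ≤ MulAction.stabilizer (K ≃ₐ[ℚ] K) x := by
      rw [Subgroup.zpowers_le]
      exact hx
    exact hle hf
  rw [IntermediateField.finrank_eq_one_iff.1 hone, mem_bot] at hmem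
  obtain ⟨q, rfl⟩ := hmem
  exact ⟨q, by simp⟩

/-- Four different numbers in a field of degree `4` that an endomorphism permutes cyclically are
all the conjugates of any one of them. -/
theorem isCyclicConjugates_of_injective {K : IntermediateField ℚ ℝ}
    (hK : Module.finrank ℚ K = 4) (τ : K →ₐ[ℚ] K) {z : Fin 4 → K} (hz : Function.Injective z)
    (hτ : ∀ i, τ (z i) = z (i + 1)) : IsCyclicConjugates (algebraMap K ℝ ∘ z) := by
  have hfin : FiniteDimensional ℚ K := FiniteDimensional.of_finrank_pos (by omega)
  have hint : IsIntegral ℚ (z 0) := Algebra.IsIntegral.isIntegral _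
  have hroot : ∀ i, Polynomial.aeval (z i) (minpoly ℚ (z 0)) = 0 := by
    have hstep : ∀ i, Polynomial.aeval (z i) (minpoly ℚ (z 0)) = 0 →
        Polynomial.aeval (z (i + 1)) (minpoly ℚ (z 0)) = 0 := by
      intro i hi
      rw [← hτ, Polynomial.aeval_algHom_apply, hi, map_zero]
    have h0 := minpoly.aeval ℚ (z 0)
    have h1 := hstep 0 h0
    have h2 := hstep 1 h1
    have h3 := hstep 2 h2
    intro i
    fin_cases i
    exacts [h0, h1, h2, h3]
  have hminR : minpoly ℚ (algebraMap K ℝ (z 0)) = minpoly ℚ (z 0) :=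
    minpoly.algebraMap_eq (algebraMap K ℝ).injective _
  have hmin : (minpoly ℚ ((algebraMap K ℝ ∘ z) 0)).map (algebraMap ℚ ℝ) =
      ∏ i, (Polynomial.X - Polynomial.C ((algebraMap K ℝ ∘ z) i)) := by
    rw [Function.comp_apply, hminR]
    refine Polynomial.eq_of_monic_of_dvd_of_natDegree_le (Polynomial.monic_prod_X_sub_C _ _)
      ((minpoly.monic hint).map _) (Finset.prod_dvd_of_coprime ?_ ?_) ?_
    · exact (Polynomial.pairwise_coprime_X_sub_C
        ((algebraMap K ℝ).injective.comp hz)).set_pairwise _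
    · intro i _
      rw [Polynomial.dvd_iff_isRoot, Polynomial.IsRoot, Polynomial.eval_map_algebraMap,
        Function.comp_apply, Polynomial.aeval_algebraMap_apply, hroot, map_zero]
    · rw [Polynomial.natDegree_map, Polynomial.natDegree_finsetProd_X_sub_C_eq_card,
        Finset.card_univ, Fintype.card_fin]
      exact (minpoly.natDegree_le _).trans_eq hK
  refine ⟨hmin, ?_⟩
  let σ : K ≃ₐ[ℚ] K := AlgEquiv.ofBijective τ (Algebra.IsAlgebraic.algHom_bijective τ)
  have hL := adjoin_range_eq hK (fun i => (z i).2) hmin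
  have hσ : ∀ i, (σ ⟨(algebraMap K ℝ ∘ z) i, (z i).2⟩ : ℝ) = (algebraMap K ℝ ∘ z) (i + 1) :=
    fun i => congrArg (algebraMap K ℝ) (hτ i)
  have htransfer : ∀ (w : Fin 4 → ℝ) (L : IntermediateField ℚ ℝ),
      L = K → ∀ hw : ∀ i, w i ∈ L,
      (∀ (h : ∀ i, w i ∈ K) (i), (σ ⟨w i, h i⟩ : ℝ) = w (i + 1)) →
      ∃ s : L ≃ₐ[ℚ] L, ∀ i, (s ⟨w i, hw i⟩ : ℝ) = w (i + 1) := by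
    rintro w L rfl hw h
    exact ⟨σ, h hw⟩
  exact htransfer _ _ hL _ fun _ => hσ

/-! ### From a proper cyclic symmetry to a normal form -/

/-- An integer matrix with eigenvalue `1` fixes a primitive integer row vector. -/
theorem exists_primitive_vecMul_eq {n : ℕ} {G : Matrix (Fin n) (Fin n) ℤ} (h : (G - 1).det = 0) :
    ∃ u b : Fin n → ℤ, u ᵥ* G = u ∧ ∑ i, b i * u i = 1 := by
  obtain ⟨u, hu0, hu⟩ := Matrix.exists_vecMul_eq_zero_iff.2 h
  obtain ⟨g, hg⟩ := (IsPrincipalIdealRing.principal (Ideal.span (Set.range u))).principal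
  have hg' : Ideal.span (Set.range u) = Ideal.span {g} := hg
  have hdvd : ∀ i, ∃ c, u i = g * c := fun i => by
    have : u i ∈ Ideal.span {g} := hg' ▸ Ideal.subset_span ⟨i, rfl⟩
    exact Ideal.mem_span_singleton.1 this
  choose c hc using hdvd
  have hg0 : g ≠ 0 := by
    rintro rfl
    exact hu0 (funext fun i => by simpa using hc i)
  obtain ⟨b, hb⟩ := (Ideal.mem_span_range_iff_exists_fun (x := g) (v := u)).1
    (hg' ▸ Ideal.mem_span_singleton_self g)
  have huc : u = g • c := funext hc
  refine ⟨c, b, ?_, ?_⟩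
  · rw [Matrix.vecMul_sub, Matrix.vecMul_one, sub_eq_zero, huc, Matrix.smul_vecMul] at hu
    exact smul_right_injective _ hg0 hu
  · apply mul_left_cancel₀ hg0
    rw [mul_one, Finset.mul_sum]
    conv_rhs => rw [← hb]
    refine Finset.sum_congr rfl fun i _ => ?_
    rw [hc i]
    ring

theorem det_sub_one_eq_zero {n : ℕ} {G : Matrix.GeneralLinearGroup (Fin n) ℤ} {x : Fin n → ℝ}
    (hx0 : x ≠ 0) (hx : act G x = x) : ((G : Matrix (Fin n) (Fin n) ℤ) - 1).det = 0 := by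
  apply (Int.castRingHom ℝ).injective_int
  rw [map_zero, RingHom.map_det]
  refine Matrix.exists_mulVec_eq_zero_iff.1 ⟨x, hx0, ?_⟩
  rw [map_sub, map_one, Matrix.sub_mulVec, Matrix.one_mulVec, sub_eq_zero]
  rw [act_apply] at hx
  exact hx

/-- Two families of vectors that are integer combinations of each other, one of them linearly
independent, differ by an invertible integer matrix. -/
theorem exists_generalLinearGroup_mulVec {n : ℕ} {K : Type*} [Field K] [Algebra ℚ K]
    {w F : Fin n → K} (hw : LinearIndependent ℚ w)
    (hF : ∀ i, ∃ r : Fin n → ℤ, F i = ∑ j, (r j : K) * w j)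
    (hwF : ∀ i, ∃ r : Fin n → ℤ, w i = ∑ j, (r j : K) * F j) :
    ∃ X : Matrix.GeneralLinearGroup (Fin n) ℤ,
      (X : Matrix (Fin n) (Fin n) ℤ).map (Int.castRingHom K) *ᵥ w = F := by
  choose P hP using hF
  choose Q hQ using hwF
  have hP' : (Matrix.of P).map (Int.castRingHom K) *ᵥ w = F := by
    ext i
    rw [hP]
    rfl
  have hQ' : (Matrix.of Q).map (Int.castRingHom K) *ᵥ F = w := by
    ext i
    conv_rhs => rw [hQ]
    rfl
  have hQP : Matrix.of Q * Matrix.of P = 1 := by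
    have hQPw : (Matrix.of Q * Matrix.of P - 1).map (Int.castRingHom K) *ᵥ w = 0 := by
      rw [Matrix.map_sub _ (map_sub _), Matrix.map_mul, Matrix.map_one _ (map_zero _) (map_one _),
        Matrix.sub_mulVec, ← Matrix.mulVec_mulVec, hP', hQ', Matrix.one_mulVec, sub_self]
    ext i j
    have hsum : ∑ j, (((Matrix.of Q * Matrix.of P - 1) i j : ℤ) : ℚ) • w j = 0 := by
      have hi := congrFun hQPw i
      rw [Matrix.mulVec, dotProduct] at hi
      simpa only [Algebra.smul_def, map_intCast, Matrix.map_apply, Int.coe_castRingHom,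
        Pi.zero_apply] using hi
    have := Fintype.linearIndependent_iff.1 hw _ hsum j
    rw [Matrix.sub_apply] at this
    exact sub_eq_zero.1 (by exact_mod_cast this)
  exact ⟨⟨Matrix.of P, Matrix.of Q, mul_eq_one_comm.1 hQP, hQP⟩, hP'⟩

/-- If an integer matrix `G` acts on a vector `w` with linearly independent coordinates like a
field endomorphism `τ` of order `4`, and fixes a row vector `u` with `u w = 1`, then the coordinates
of `w` generate a cyclic lattice. -/
theorem isCyclicLattice_of_mulVec_eq {K : IntermediateField ℚ ℝ} (hK : Module.finrank ℚ K = 4)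
    {τ : K →ₐ[ℚ] K} {w : Fin 4 → K} (hw : LinearIndependent ℚ w)
    {G : Matrix (Fin 4) (Fin 4) ℤ} (hG : G.map (Int.castRingHom K) *ᵥ w = τ ∘ w)
    {u b : Fin 4 → ℤ} (hub : ∑ i, b i * u i = 1) (huw : ∑ i, (u i : K) * w i = 1)
    (h4 : ∀ x, τ (τ (τ (τ x))) = x) {x₀ : K} (h2 : τ (τ x₀) ≠ x₀) :
    IsCyclicLattice τ (AddSubgroup.closure (Set.range w)) ∧
      ∀ x ∈ AddSubgroup.closure (Set.range w), ∃ r : Fin 4 → ℤ, x = ∑ i, (r i : K) * w i := by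
  have hfin : FiniteDimensional ℚ K := FiniteDimensional.of_finrank_pos (by omega)
  have hmem : ∀ i, w i ∈ AddSubgroup.closure (Set.range w) := fun i =>
    AddSubgroup.subset_closure ⟨i, rfl⟩
  have hsum : ∀ r : Fin 4 → ℤ, ∑ i, (r i : K) * w i ∈ AddSubgroup.closure (Set.range w) :=
    fun r => AddSubgroup.sum_mem _ fun i _ => by
      rw [← zsmul_eq_mul]
      exact AddSubgroup.zsmul_mem _ (hmem i) _
  have hcomb : ∀ x ∈ AddSubgroup.closure (Set.range w),
      ∃ r : Fin 4 → ℤ, x = ∑ i, (r i : K) * w i := by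
    intro x hx
    induction hx using AddSubgroup.closure_induction with
    | mem x hx =>
      obtain ⟨i, rfl⟩ := hx
      exact ⟨Pi.single i 1, by simp [Pi.single_apply]⟩
    | zero => exact ⟨0, by simp⟩
    | add x y _ _ hx hy =>
      obtain ⟨r, rfl⟩ := hx
      obtain ⟨s, rfl⟩ := hy
      exact ⟨r + s, by simp [add_mul, Finset.sum_add_distrib]⟩
    | neg x _ hx =>
      obtain ⟨r, rfl⟩ := hx
      exact ⟨-r, by simp⟩
  refine ⟨⟨huw ▸ hsum u, ?_, h4, fun x => rat_of_fixed hK h4 h2, ?_, ?_⟩, hcomb⟩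
  · intro x hx
    induction hx using AddSubgroup.closure_induction with
    | mem x hx =>
      obtain ⟨i, rfl⟩ := hx
      have := congrFun hG i
      rw [Function.comp_apply] at this
      rw [← this]
      exact hsum (G i)
    | zero => rw [map_zero]; exact AddSubgroup.zero_mem _
    | add x y _ _ hx hy => rw [map_add]; exact AddSubgroup.add_mem _ hx hy
    | neg x _ hx => rw [map_neg]; exact AddSubgroup.neg_mem _ hx
  · -- a rational number `q = r w` in the lattice is `q u w`, so that `r = q u` with `u` primitive
    intro q hq
    obtain ⟨r, hr⟩ := hcomb _ hq
    have hzero : ∑ i, ((r i : ℚ) - q * u i) • w i = 0 := by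
      have : (q : K) = q * ∑ i, (u i : K) * w i := by rw [huw, mul_one]
      rw [hr, Finset.mul_sum] at this
      rw [← sub_eq_zero, ← Finset.sum_sub_distrib] at this
      rw [← this]
      refine Finset.sum_congr rfl fun i _ => ?_
      rw [Algebra.smul_def, eq_ratCast]
      push_cast
      rw [sub_mul, ← hr]
      ring
    have hri : ∀ i, (r i : ℚ) = q * u i := fun i =>
      sub_eq_zero.1 (Fintype.linearIndependent_iff.1 hw _ hzero i)
    refine ⟨∑ i, b i * r i, ?_⟩
    have hub' : ∑ i, (b i : ℚ) * u i = 1 := by exact_mod_cast hub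
    push_cast
    simp only [hri, mul_left_comm _ q, ← Finset.mul_sum, hub', mul_one]
  · obtain ⟨N, hN, hint⟩ := exists_integral_multiples ℤ ℚ (Finset.univ.image w)
    refine ⟨N, hN, fun x hx => ?_⟩
    induction hx using AddSubgroup.closure_induction with
    | mem x hx =>
      obtain ⟨i, rfl⟩ := hx
      exact hint _ (Finset.mem_image_of_mem _ (Finset.mem_univ i))
    | zero => rw [smul_zero]; exact isIntegral_zero
    | add x y _ _ hx hy => rw [smul_add]; exact hx.add hy
    | neg x _ hx => rw [smul_neg]; exact hx.neg

/-- The normal form of the lattice generated by the coordinates of `w`. -/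
theorem exists_normalForm_of_mulVec_eq {K : IntermediateField ℚ ℝ}
    (hK : Module.finrank ℚ K = 4)
    {τ : K →ₐ[ℚ] K} {w : Fin 4 → K} (hw : LinearIndependent ℚ w)
    {G : Matrix (Fin 4) (Fin 4) ℤ} (hG : G.map (Int.castRingHom K) *ᵥ w = τ ∘ w)
    {u b : Fin 4 → ℤ} (hub : ∑ i, b i * u i = 1) (huw : ∑ i, (u i : K) * w i = 1)
    (h4 : ∀ x, τ (τ (τ (τ x))) = x) (h2 : ∃ i, τ (τ (w i)) ≠ w i)
    {v : Fin 4 → ℝ} {κ : ℝ} (hκ : κ ≠ 0) (hv : v = κ • (algebraMap K ℝ ∘ w)) :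
    ∃ a b c d : ℝ, IsCyclicConjugates ![a, b, c, d] ∧ ∃ k, NormalForm v a b c d k := by
  obtain ⟨i₀, hi₀⟩ := h2
  obtain ⟨hM, hcomb⟩ := isCyclicLattice_of_mulVec_eq hK hw hG hub huw h4 hi₀
  obtain ⟨ω, k, htr, hF, hgen⟩ := hM.exists_frame
  have hω2 : τ (τ ω) ≠ ω := by
    intro h
    have hfr : ∀ j, τ (τ (frame ω (τ ω) (τ (τ ω)) k j)) = frame ω (τ ω) (τ (τ ω)) k j := by
      intro j
      have h1 := congrFun (map_frame ((τ : K →+* K).comp (τ : K →+* K)) ω (τ ω) (τ (τ ω)) k) j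
      simpa [h] using h1
    obtain ⟨c, hc⟩ := hgen (w i₀) (AddSubgroup.subset_closure ⟨i₀, rfl⟩)
    apply hi₀
    rw [hc]
    simp only [map_sum, map_mul, map_intCast, hfr]
  have hinj : Function.Injective ![ω, τ ω, τ (τ ω), τ (τ (τ ω))] := by
    have h01 : τ ω ≠ ω := fun h => hω2 (by rw [h, h])
    have h12 : τ (τ ω) ≠ τ ω := fun h => h01 (τ.injective h)
    have h23 : τ (τ (τ ω)) ≠ τ (τ ω) := fun h => h12 (τ.injective h)
    have h13 : τ (τ (τ ω)) ≠ τ ω := fun h => hω2 (τ.injective h)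
    have h03 : τ (τ (τ ω)) ≠ ω := fun h =>
      h01 ((congrArg τ h).symm.trans (h4 ω))
    intro i j hij
    fin_cases i <;> fin_cases j <;> first | rfl | (exfalso; simp at hij; tauto)
  have hcyc := isCyclicConjugates_of_injective hK τ hinj (by
    intro i
    fin_cases i
    · rfl
    · rfl
    · rfl
    · exact h4 ω)
  have hvec : algebraMap K ℝ ∘ ![ω, τ ω, τ (τ ω), τ (τ (τ ω))] =
      ![(ω : ℝ), (τ ω : K), (τ (τ ω) : K), (τ (τ (τ ω)) : K)] := by
    ext i
    fin_cases i <;> rfl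
  rw [hvec] at hcyc
  refine ⟨_, _, _, _, hcyc, k, (normalForm_iff _ _ _ _ _ _).2 ⟨?_, ?_⟩⟩
  · obtain ⟨X, hX⟩ := exists_generalLinearGroup_mulVec hw (fun i => hcomb _ (hF i))
      (fun i => hgen _ (AddSubgroup.subset_closure ⟨i, rfl⟩))
    refine ⟨X, κ, hκ, ?_⟩
    rw [hv, map_smul, act_comp_algebraMap, hX, map_frame]
    rfl
  · have := congrArg (algebraMap K ℝ) htr
    simpa using this

/-- Vectors of a line on which a linear form takes the value `1` are equal. -/
theorem eq_of_mem_span_singleton {n : ℕ} {u : Fin n → ℤ} {x p q : Fin n → ℝ}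
    (hp : p ∈ Submodule.span ℝ {x}) (hq : q ∈ Submodule.span ℝ {x})
    (hup : ∑ i, (u i : ℝ) * p i = 1) (huq : ∑ i, (u i : ℝ) * q i = 1) : p = q := by
  obtain ⟨c, rfl⟩ := Submodule.mem_span_singleton.1 hp
  obtain ⟨d, rfl⟩ := Submodule.mem_span_singleton.1 hq
  simp only [Pi.smul_apply, smul_eq_mul, mul_left_comm (u _ : ℝ), ← Finset.mul_sum] at hup huq
  have hne : ∑ i, (u i : ℝ) * x i ≠ 0 := right_ne_zero_of_mul_eq_one hup
  rw [mul_right_cancel₀ hne (hup.trans huq.symm)]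

/-- The endomorphism of the field generated by an eigenvalue `lam` that maps `lam` to another
eigenvalue. -/
theorem exists_algHom_gen_eq {n : ℕ} {A : Matrix.GeneralLinearGroup (Fin n) ℤ}
    (hA : IsHyperbolic A) {lam : ℝ} (hlam : Module.End.HasEigenvalue (act A) lam)
    {mu : ℚ⟮lam⟯} (hmu : Module.End.HasEigenvalue (act A) (mu : ℝ)) :
    ∃ τ : ℚ⟮lam⟯ →ₐ[ℚ] ℚ⟮lam⟯, τ (AdjoinSimple.gen ℚ lam) = mu := by
  have hint := isIntegral_eigenvalue hA hlam
  have hroot : mu ∈ (minpoly ℚ lam).aroots ℚ⟮lam⟯ := by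
    rw [Polynomial.mem_aroots]
    refine ⟨minpoly.ne_zero hint, ?_⟩
    rw [minpoly_eigenvalue hA hlam, ← minpoly_eigenvalue hA hmu]
    have h := minpoly.aeval ℚ mu
    rwa [← minpoly.algebraMap_eq (algebraMap ℚ⟮lam⟯ ℝ).injective] at h
  exact ⟨_, algHomAdjoinIntegralEquiv_symm_apply_gen ℚ hint ⟨mu, hroot⟩⟩

/-- The symmetry provides an eigenvector `w` and a field endomorphism `τ` with `G w = τ w`, to which
the classification of cyclic lattices applies. -/
theorem exists_normalForm_of_hasProperCyclicSymmetry
    {l : Fin 4 → Submodule ℝ (Fin 4 → ℝ)} {v : Fin 4 → ℝ} (hl : IsAlgebraicCF l)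
    (hv : l 0 = Submodule.span ℝ {v}) (hv0 : v 0 = 1) (h : HasProperCyclicSymmetry l) :
    ∃ a b c d : ℝ, IsCyclicConjugates ![a, b, c, d] ∧ ∃ k, NormalForm v a b c d k := by
  obtain ⟨A, hA, ev, hinj, hev⟩ := hl
  obtain ⟨G, ⟨-, s, hs, hsupp, hperm⟩, -, C, hC, p, hp, hpG⟩ := h
  obtain ⟨x, hx⟩ := exists_basis_eigenspace (act A) hinj fun i => (hev i).1
  have hlx : ∀ i, l i = Submodule.span ℝ {x i} := fun i => (hev i).2.trans (hx i)
  have hp0 : p ≠ 0 := by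
    rintro rfl
    exact zero_notMem_closure_kleinPolyhedron x hlx hC (frontier_subset_closure hp)
  obtain ⟨u, b, hu, hub⟩ := exists_primitive_vecMul_eq (det_sub_one_eq_zero hp0 hpG)
  have hGl : ∀ i, ∀ z ∈ l i, act G z ∈ l (s i) := fun i z hz =>
    hperm i ▸ Submodule.mem_map_of_mem hz
  have hord : orderOf s = 4 := by rw [hs.orderOf, hsupp]; rfl
  have hs4 : s (s (s (s 0))) = 0 := by
    have := congrArg (fun f : Equiv.Perm (Fin 4) => f 0) (hord ▸ pow_orderOf_eq_one s)
    simpa [pow_succ] using this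
  have hs2 : s (s 0) ≠ 0 := by
    intro h0
    have hmem : s 0 ≠ 0 := by
      rw [← Equiv.Perm.mem_support, hsupp]
      exact Finset.mem_univ _
    have h1 : s ^ 2 = 1 := hs.pow_eq_one_iff.2 ⟨0, hmem, by simpa [pow_succ] using h0⟩
    have := orderOf_dvd_of_pow_eq_one h1
    rw [hord] at this
    norm_num at this
  -- the eigenvector `w`, with coordinates in the field of the eigenvalue and `u w = 1`
  have hK := finrank_adjoin_eigenvalue hA (hev 0).1
  obtain ⟨y, hy⟩ := exists_comp_algebraMap_eq (hev 0).1 ((hev 0).2.symm.trans hv) hv0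
  have hy0 : y 0 = 1 := (algebraMap ℚ⟮ev 0⟯ ℝ).injective (by
    rw [map_one, ← hv0, ← hy, Function.comp_apply])
  have hyl : algebraMap ℚ⟮ev 0⟯ ℝ ∘ y ∈ l 0 := by
    rw [hy, hv]
    exact Submodule.mem_span_singleton_self v
  have hyli := linearIndependent_eigenvector hA (hev 0).1 ((hev 0).2 ▸ hyl) hy0
  set κ : ℚ⟮ev 0⟯ := ∑ i, (u i : ℚ⟮ev 0⟯) * y i with hκ
  have hκ0 : κ ≠ 0 := by
    intro h0
    have hzero : ∑ i, (u i : ℚ) • y i = 0 := by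
      rw [← h0, hκ]
      simp [Algebra.smul_def]
    have hui : ∀ i, u i = 0 := fun i => by
      exact_mod_cast Fintype.linearIndependent_iff.1 hyli _ hzero i
    simp [hui] at hub
  set w : Fin 4 → ℚ⟮ev 0⟯ := κ⁻¹ • y with hw
  have hwli : LinearIndependent ℚ w := by
    refine Fintype.linearIndependent_iff.2 fun g hg => Fintype.linearIndependent_iff.1 hyli g ?_
    have : κ⁻¹ * ∑ i, g i • y i = 0 := by
      rw [← hg, Finset.mul_sum]
      simp [hw]
    exact (mul_eq_zero.1 this).resolve_left (inv_ne_zero hκ0)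
  have hvw : v = (κ : ℝ) • (algebraMap ℚ⟮ev 0⟯ ℝ ∘ w) := by
    rw [← hy]
    ext i
    have : y i = κ * w i := by
      rw [hw, Pi.smul_apply, smul_eq_mul, mul_inv_cancel_left₀ hκ0]
    rw [Function.comp_apply, this, map_mul]
    rfl
  have hκR : (κ : ℝ) ≠ 0 := fun h0 => hκ0 (Subtype.ext h0)
  have hwl : algebraMap ℚ⟮ev 0⟯ ℝ ∘ w ∈ l 0 := by
    have : algebraMap ℚ⟮ev 0⟯ ℝ ∘ w = (κ : ℝ)⁻¹ • v := by
      rw [hvw, inv_smul_smul₀ hκR]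
    rw [this, hv]
    exact Submodule.smul_mem _ _ (Submodule.mem_span_singleton_self v)
  have huw : ∑ i, (u i : ℚ⟮ev 0⟯) * w i = 1 := by
    simp only [hw, Pi.smul_apply, smul_eq_mul, mul_left_comm _ κ⁻¹, ← Finset.mul_sum, ← hκ]
    exact inv_mul_cancel₀ hκ0
  have hunorm : ∀ z : Fin 4 → ℚ⟮ev 0⟯, ∑ i, (u i : ℚ⟮ev 0⟯) * z i = 1 →
      ∑ i, (u i : ℝ) * (algebraMap ℚ⟮ev 0⟯ ℝ ∘ z) i = 1 := by
    intro z hz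
    have := congrArg (algebraMap ℚ⟮ev 0⟯ ℝ) hz
    simpa only [map_sum, map_mul, map_intCast, map_one, Function.comp_apply] using this
  set GK := (G : Matrix (Fin 4) (Fin 4) ℤ).map (Int.castRingHom ℚ⟮ev 0⟯) with hGK
  set AK := (A : Matrix (Fin 4) (Fin 4) ℤ).map (Int.castRingHom ℚ⟮ev 0⟯) with hAK
  have huG : ∀ z : Fin 4 → ℚ⟮ev 0⟯,
      ∑ i, (u i : ℚ⟮ev 0⟯) * (GK *ᵥ z) i = ∑ i, (u i : ℚ⟮ev 0⟯) * z i := by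
    intro z
    have huK : (fun i => (u i : ℚ⟮ev 0⟯)) ᵥ* GK = fun i => (u i : ℚ⟮ev 0⟯) := by
      ext1 i
      have h1 := RingHom.map_vecMul (Int.castRingHom ℚ⟮ev 0⟯) (G : Matrix (Fin 4) (Fin 4) ℤ) u i
      rw [hu] at h1
      exact h1.symm
    have h2 := Matrix.dotProduct_mulVec (fun i => (u i : ℚ⟮ev 0⟯)) GK z
    rw [huK] at h2
    exact h2
  -- the eigenvalue of `G w` lies in the field as well
  have hw1l : algebraMap ℚ⟮ev 0⟯ ℝ ∘ (GK *ᵥ w) ∈ l (s 0) := by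
    rw [hGK, ← act_comp_algebraMap]
    exact hGl 0 _ hwl
  obtain ⟨mu, hmu⟩ : ∃ mu : ℚ⟮ev 0⟯, (mu : ℝ) = ev (s 0) := by
    have hne : ∃ i, (GK *ᵥ w) i ≠ 0 := by
      by_contra! h0
      have := huG w
      rw [huw] at this
      simp [h0] at this
    obtain ⟨i, hi⟩ := hne
    refine ⟨(AK *ᵥ (GK *ᵥ w)) i / (GK *ᵥ w) i, ?_⟩
    rw [(hev (s 0)).2, Module.End.mem_eigenspace_iff, act_comp_algebraMap] at hw1l
    have h1 := congrFun hw1l i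
    have hi' : algebraMap ℚ⟮ev 0⟯ ℝ ((GK *ᵥ w) i) ≠ 0 := by
      rwa [Ne, map_eq_zero_iff _ (algebraMap ℚ⟮ev 0⟯ ℝ).injective]
    exact (map_div₀ (algebraMap ℚ⟮ev 0⟯ ℝ) _ _).trans ((div_eq_iff hi').2 h1)
  obtain ⟨τ, hτ⟩ := exists_algHom_gen_eq hA (hev 0).1 (mu := mu) (hmu ▸ (hev (s 0)).1)
  have hAw : AK *ᵥ w = AdjoinSimple.gen ℚ (ev 0) • w := by
    have h1 := hwl
    rw [(hev 0).2, Module.End.mem_eigenspace_iff, act_comp_algebraMap] at h1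
    refine funext fun i => ?_
    have h2 := congrFun h1 i
    rw [Function.comp_apply] at h2
    refine (algebraMap ℚ⟮ev 0⟯ ℝ).injective (h2.trans ?_)
    simp
  have hτwl : algebraMap ℚ⟮ev 0⟯ ℝ ∘ (τ ∘ w) ∈ l (s 0) := by
    rw [(hev (s 0)).2, Module.End.mem_eigenspace_iff, act_comp_algebraMap]
    have h1 := comp_intMatrix_mulVec (τ : ℚ⟮ev 0⟯ →+* ℚ⟮ev 0⟯) (A : Matrix (Fin 4) (Fin 4) ℤ) w
    have h2 : AK *ᵥ (τ ∘ w) = mu • (τ ∘ w) := by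
      refine h1.symm.trans ?_
      rw [← hAK, hAw]
      ext i
      simp [hτ]
    rw [← hAK, h2, ← hmu]
    ext i
    simp
  have huτ : ∀ f : ℚ⟮ev 0⟯ →ₐ[ℚ] ℚ⟮ev 0⟯, ∀ z : Fin 4 → ℚ⟮ev 0⟯,
      ∑ i, (u i : ℚ⟮ev 0⟯) * z i = 1 → ∑ i, (u i : ℚ⟮ev 0⟯) * (f ∘ z) i = 1 := by
    intro f z hz
    have := congrArg f hz
    simpa only [map_sum, map_mul, map_intCast, map_one, Function.comp_apply] using this
  -- `G w` and `τ w` lie on the same line and agree under `u`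
  have hGw : GK *ᵥ w = τ ∘ w := by
    have h1 := eq_of_mem_span_singleton (hlx (s 0) ▸ hw1l) (hlx (s 0) ▸ hτwl)
      (hunorm _ ((huG w).trans huw)) (hunorm _ (huτ τ w huw))
    exact (algebraMap ℚ⟮ev 0⟯ ℝ).injective.comp_left h1
  have hstep : ∀ z : Fin 4 → ℚ⟮ev 0⟯, GK *ᵥ z = τ ∘ z → ∀ i,
      algebraMap ℚ⟮ev 0⟯ ℝ ∘ z ∈ l i →
      GK *ᵥ (τ ∘ z) = τ ∘ (τ ∘ z) ∧ algebraMap ℚ⟮ev 0⟯ ℝ ∘ (τ ∘ z) ∈ l (s i) := by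
    intro z hz i hzl
    constructor
    · conv_rhs => rw [← hz]
      exact (comp_intMatrix_mulVec (τ : ℚ⟮ev 0⟯ →+* ℚ⟮ev 0⟯) _ z).symm
    · rw [← hz, hGK, ← act_comp_algebraMap]
      exact hGl i _ hzl
  obtain ⟨hG1, hl1⟩ := hstep w hGw 0 hwl
  obtain ⟨hG2, hl2⟩ := hstep _ hG1 _ hl1
  obtain ⟨hG3, hl3⟩ := hstep _ hG2 _ hl2
  obtain ⟨-, hl4⟩ := hstep _ hG3 _ hl3
  have hw4 : τ ∘ (τ ∘ (τ ∘ (τ ∘ w))) = w := by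
    rw [hs4] at hl4
    exact (algebraMap ℚ⟮ev 0⟯ ℝ).injective.comp_left (eq_of_mem_span_singleton (hlx 0 ▸ hl4)
      (hlx 0 ▸ hwl) (hunorm _ (huτ τ _ (huτ τ _ (huτ τ _ (huτ τ w huw))))) (hunorm _ huw))
  have h4 : ∀ z, τ (τ (τ (τ z))) = z := by
    have hbasis : ∀ i, (basisOfLinearIndependentOfCardEqFinrank hwli
        (by rw [hK, Fintype.card_fin])) i = w i := fun i => by simp
    have : (((τ.comp τ).comp τ).comp τ).toLinearMap = LinearMap.id := by
      refine (basisOfLinearIndependentOfCardEqFinrank hwli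
        (by rw [hK, Fintype.card_fin])).ext fun i => ?_
      rw [hbasis]
      exact congrFun hw4 i
    exact fun z => LinearMap.congr_fun this z
  have h2 : ∃ i, τ (τ (w i)) ≠ w i := by
    by_contra! h0
    have h1 : τ ∘ (τ ∘ w) = w := funext h0
    rw [h1, hlx] at hl2
    have h3 := hwl
    rw [hlx] at h3
    obtain ⟨c, hc⟩ := Submodule.mem_span_singleton.1 hl2
    obtain ⟨d, hd⟩ := Submodule.mem_span_singleton.1 h3
    have hcd := congrArg (fun z => x.repr z (s (s 0))) (hc.trans hd.symm)
    simp only [map_smul, x.repr_self, Finsupp.smul_apply, Finsupp.single_eq_same,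
      Finsupp.single_eq_of_ne hs2, smul_eq_mul, mul_one, mul_zero] at hcd
    have h5 := hunorm w huw
    rw [← hc, hcd] at h5
    simp at h5
  exact exists_normalForm_of_mulVec_eq hK hwli hGw hub huw h4 h2 hκR hvw

/-! ### From a normal form to a proper cyclic symmetry -/

/-- The integer matrix of the conjugation `ω ↦ ω' ↦ ω'' ↦ ω''' ↦ ω` in the basis given by the
`k`-th normal form. -/
def frameMatrix : Fin 7 → Matrix (Fin 4) (Fin 4) ℤ :=
  ![!![1, 0, 0, 0; 0, 0, 1, 0; 0, 0, 0, 1; 0, -1, -1, -1],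
    !![1, 0, 0, 0; 0, 0, 1, 0; 0, 0, 0, 1; 1, -1, -1, -1],
    !![1, 0, 0, 0; 0, 0, 1, 0; 0, 0, 0, 1; 2, -1, -1, -1],
    !![1, 0, 0, 0; 0, 0, 1, 0; 0, -1, 0, 2; 0, 0, 0, -1],
    !![1, 0, 0, 0; 0, 0, 1, 0; 0, -1, 0, 2; 1, 0, 0, -1],
    !![1, 0, 0, 0; 0, 0, 1, 0; -1, -1, 0, 2; 1, 0, 0, -1],
    !![1, 0, 0, 0; 0, 0, 1, 0; -1, -1, 0, 2; 2, 0, 0, -1]]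

theorem frameMatrix_mulVec {F : Type*} [Field F] [CharZero F] {a b c d : F} {k : Fin 7}
    (h : a + b + c + d = frameTrace k) :
    (frameMatrix k).map (Int.castRingHom F) *ᵥ frame a b c k = frame b c d k := by
  have hd : d = frameTrace k - a - b - c := by linear_combination h
  subst hd
  ext i
  fin_cases k <;> fin_cases i <;>
    simp [frameMatrix, frame, frameTrace, Matrix.mulVec, dotProduct, Fin.sum_univ_four] <;> ring

/-- The conjugation matrix as an element of `GL₄(ℤ)`; it is invertible because its fourth power
is `1`. -/
noncomputable def frameGL (k : Fin 7) : Matrix.GeneralLinearGroup (Fin 4) ℤ :=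
  Units.ofPowEqOne (frameMatrix k) 4 (by revert k; decide) (by norm_num)

theorem coe_frameGL (k : Fin 7) : (frameGL k : Matrix (Fin 4) (Fin 4) ℤ) = frameMatrix k := rfl

theorem det_frameMatrix_sub_one (k : Fin 7) : (frameMatrix k - 1).det = 0 := by
  refine Matrix.det_eq_zero_of_row_eq_zero 0 fun j => ?_
  revert k j
  decide

theorem mem_of_frame_mem {L : IntermediateField ℚ ℝ} {a b c : ℝ} {k : Fin 7}
    (h : ∀ i, frame a b c k i ∈ L) : a ∈ L ∧ b ∈ L ∧ c ∈ L := by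
  have ha : a ∈ L := frame_one a b c k ▸ h 1
  refine ⟨ha, frame_two a b c k ▸ h 2, ?_⟩
  have h3 := h 3
  have h2 : (2 : ℝ) ∈ L := ofNat_mem L 2
  revert h3
  have key : ∀ u : ℝ, u ∈ L → (a + c + u) / 2 ∈ L → c ∈ L := by
    intro u hu h
    have := L.sub_mem (L.sub_mem (L.mul_mem h2 h) ha) hu
    convert this using 1
    ring
  fin_cases k
  · exact id
  · exact id
  · exact id
  · exact fun h => key 0 L.zero_mem (by simpa [frame] using h)
  · exact fun h => key 0 L.zero_mem (by simpa [frame] using h)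
  · exact fun h => key 1 L.one_mem (by simpa [frame] using h)
  · exact fun h => key 1 L.one_mem (by simpa [frame] using h)

theorem act_apply_mem {n : ℕ} {L : IntermediateField ℚ ℝ}
    (X : Matrix.GeneralLinearGroup (Fin n) ℤ) {v : Fin n → ℝ} (hv : ∀ i, v i ∈ L) (i : Fin n) :
    act X v i ∈ L := by
  rw [act_apply, Matrix.mulVec, dotProduct]
  exact L.sum_mem fun j _ => L.mul_mem (by simp) (hv j)

/-- A field that contains the coordinates of `v` contains the scalar in an equivalence of `v` with
a vector whose first coordinate is `1`, and hence the numbers in the normal form of `v`. -/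
theorem mem_of_normalForm {L : IntermediateField ℚ ℝ} {v : Fin 4 → ℝ} (hv : ∀ i, v i ∈ L)
    {a b c d : ℝ} {k : Fin 7} (h : NormalForm v a b c d k) (i : Fin 4) : ![a, b, c, d] i ∈ L := by
  obtain ⟨⟨X, μ, hμ, hX⟩, htr⟩ := (normalForm_iff _ _ _ _ _ _).1 h
  have hXi : ∀ i, μ * frame a b c k i ∈ L := fun i => by
    have := act_apply_mem X hv i
    rwa [hX] at this
  have hμL : μ ∈ L := by simpa [frame_zero] using hXi 0
  obtain ⟨ha, hb, hc⟩ := mem_of_frame_mem (a := a) (b := b) (c := c) (k := k) (L := L) fun i => by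
    have := L.mul_mem (L.inv_mem hμL) (hXi i)
    rwa [inv_mul_cancel_left₀ hμ] at this
  have hd : d = frameTrace k - a - b - c := by linear_combination htr
  fin_cases i
  · exact ha
  · exact hb
  · exact hc
  · change d ∈ L
    rw [hd]
    exact L.sub_mem (L.sub_mem (L.sub_mem (by simp) ha) hb) hc

theorem IsCyclicConjugates.minpoly_ne_zero {w : Fin 4 → ℝ} (h : IsCyclicConjugates w) :
    minpoly ℚ (w 0) ≠ 0 := by
  intro h0
  have := h.1
  rw [h0, Polynomial.map_zero] at this
  exact (Polynomial.monic_prod_X_sub_C w Finset.univ).ne_zero this.symm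

theorem IsCyclicConjugates.injective {w : Fin 4 → ℝ} (h : IsCyclicConjugates w) :
    Function.Injective w := by
  have hsep := (minpoly.irreducible (minpoly.ne_zero_iff.1 h.minpoly_ne_zero)).separable
  rw [← Polynomial.separable_map (algebraMap ℚ ℝ), h.1] at hsep
  exact Polynomial.separable_prod_X_sub_C_iff.1 hsep

theorem IsCyclicConjugates.normal {w : Fin 4 → ℝ} (h : IsCyclicConjugates w) :
    Normal ℚ (IntermediateField.adjoin ℚ (Set.range w)) := by
  have hroot : (minpoly ℚ (w 0)).rootSet ℝ = Set.range w := by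
    ext x
    rw [Polynomial.mem_rootSet_of_ne h.minpoly_ne_zero, ← Polynomial.eval_map_algebraMap, h.1,
      Polynomial.eval_prod, Finset.prod_eq_zero_iff]
    simp [sub_eq_zero, eq_comm]
  have hsplits : ((minpoly ℚ (w 0)).map (algebraMap ℚ ℝ)).Splits := by
    rw [h.1]
    exact Polynomial.Splits.prod fun i _ => Polynomial.Splits.X_sub_C _
  have hnormal := Normal.of_isSplittingField (hFEp := adjoin_rootSet_isSplittingField hsplits)
  rw [hroot] at hnormal
  -- the two `ℚ`-algebra structures on the subfield agree
  convert hnormal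
  exact Subsingleton.elim _ _

/-- Both the field of the four conjugates and the field of the coordinates of the eigenvector
coincide with the field of the eigenvalue. -/
theorem adjoin_eq_of_normalForm {K : IntermediateField ℚ ℝ} (hK : Module.finrank ℚ K = 4)
    {v : Fin 4 → ℝ} (hv : ∀ i, v i ∈ K) {a b c d : ℝ} (hw : IsCyclicConjugates ![a, b, c, d])
    {k : Fin 7} (h : NormalForm v a b c d k) :
    IntermediateField.adjoin ℚ (Set.range ![a, b, c, d]) = K ∧
      IntermediateField.adjoin ℚ (Set.range v) = K := by
  have hL := adjoin_range_eq hK (mem_of_normalForm hv h) hw.1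
  refine ⟨hL, le_antisymm ?_ ?_⟩
  · rw [adjoin_le_iff]
    rintro _ ⟨i, rfl⟩
    exact hv i
  · conv_lhs => rw [← hL]
    rw [adjoin_le_iff]
    rintro _ ⟨i, rfl⟩
    exact mem_of_normalForm (fun i => subset_adjoin ℚ (Set.range v) ⟨i, rfl⟩) h i

/-- Shifting a numbering `e` of the lines cyclically is a permutation of the lines that is a single
cycle of full length. -/
theorem isCycle_conj_finRotate (e : Equiv.Perm (Fin 4)) :
    (e * finRotate 4 * e⁻¹).IsCycle ∧ (e * finRotate 4 * e⁻¹).support = Finset.univ ∧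
      ∀ i, (e * finRotate 4 * e⁻¹) (e i) = e (i + 1) := by
  refine ⟨isCycle_finRotate.conj, ?_, fun i => ?_⟩
  · rw [Equiv.Perm.support_conj, support_finRotate, Finset.map_univ_equiv]
  · rw [Equiv.Perm.mul_apply, Equiv.Perm.mul_apply, ← Equiv.Perm.mul_apply e⁻¹ e, inv_mul_cancel,
      Equiv.Perm.one_apply, finRotate_apply]

/-- If `G` acts on an eigenvector `y` over the field of the eigenvalue like a field automorphism
`σ` that permutes four conjugates cyclically, then `G` permutes the four eigenlines cyclically. -/
theorem exists_permutesBy {l : Fin 4 → Submodule ℝ (Fin 4 → ℝ)}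
    {A : Matrix.GeneralLinearGroup (Fin 4) ℤ} {ev : Fin 4 → ℝ} (hinj : Function.Injective ev)
    (hev : ∀ i, Module.End.HasEigenvalue (act A) (ev i) ∧
      l i = Module.End.eigenspace (act A) (ev i))
    {y : Fin 4 → ℚ⟮ev 0⟯} (hy0 : y ≠ 0) (hyl : algebraMap ℚ⟮ev 0⟯ ℝ ∘ y ∈ l 0)
    {G : Matrix.GeneralLinearGroup (Fin 4) ℤ} {σ : ℚ⟮ev 0⟯ →ₐ[ℚ] ℚ⟮ev 0⟯}
    (hG : (G : Matrix (Fin 4) (Fin 4) ℤ).map (Int.castRingHom ℚ⟮ev 0⟯) *ᵥ y = σ ∘ y)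
    {z : Fin 4 → ℚ⟮ev 0⟯} (hz : Function.Injective z) (hσz : ∀ i, σ (z i) = z (i + 1))
    (hspan : IntermediateField.adjoin ℚ (Set.range (algebraMap ℚ⟮ev 0⟯ ℝ ∘ z)) = ℚ⟮ev 0⟯) :
    ∃ s : Equiv.Perm (Fin 4), s.IsCycle ∧ s.support = Finset.univ ∧ PermutesBy l G s := by
  obtain ⟨x, hx⟩ := exists_basis_eigenspace (act A) hinj fun i => (hev i).1
  have hlx : ∀ i, l i = Submodule.span ℝ {x i} := fun i => (hev i).2.trans (hx i)
  have hσpow : ∀ n : ℕ, ∀ i, (σ ^ n) (z i) = z (i + (Fin.ofNat 4 n)) := by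
    intro n
    induction n with
    | zero => intro i; simp
    | succ n ih =>
      intro i
      rw [pow_succ', AlgHom.mul_apply, ih, hσz]
      congr 1
      ext
      simp [Fin.val_add, add_assoc]
  have hσ4 : σ ^ 4 = 1 := by
    refine algHom_ext_of_eq_adjoin ℚ hspan.symm ?_
    rintro _ ⟨i, rfl⟩
    have h1 := hσpow 4 i
    have h2 : ∀ i : Fin 4, i + Fin.ofNat 4 4 = i := by decide
    rw [h2] at h1
    exact h1
  -- the conjugates of the eigenvalue are four different eigenvalues
  set gen := AdjoinSimple.gen ℚ (ev 0) with hgen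
  have hlin : ∀ n : ℕ, algebraMap ℚ⟮ev 0⟯ ℝ ∘ ((σ ^ n) ∘ y) ∈
      Module.End.eigenspace (act A) ((σ ^ n) gen : ℝ) := by
    intro n
    rw [Module.End.mem_eigenspace_iff, act_comp_algebraMap]
    have h1 := comp_intMatrix_mulVec ((σ ^ n : ℚ⟮ev 0⟯ →ₐ[ℚ] ℚ⟮ev 0⟯) : ℚ⟮ev 0⟯ →+* ℚ⟮ev 0⟯)
      (A : Matrix (Fin 4) (Fin 4) ℤ) y
    have h2 : (A : Matrix (Fin 4) (Fin 4) ℤ).map (Int.castRingHom ℚ⟮ev 0⟯) *ᵥ y = gen • y := by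
      have h3 := hyl
      rw [(hev 0).2, Module.End.mem_eigenspace_iff, act_comp_algebraMap] at h3
      refine funext fun i => ?_
      have h4 := congrFun h3 i
      rw [Function.comp_apply] at h4
      refine (algebraMap ℚ⟮ev 0⟯ ℝ).injective (h4.trans ?_)
      simp [hgen]
    rw [h2] at h1
    refine (congrArg (fun t => algebraMap ℚ⟮ev 0⟯ ℝ ∘ t) h1.symm).trans ?_
    refine funext fun i => ?_
    simp
  have hne : ∀ n : ℕ, algebraMap ℚ⟮ev 0⟯ ℝ ∘ ((σ ^ n) ∘ y) ≠ 0 := by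
    intro n h0
    refine hy0 (funext fun i => ?_)
    exact (map_eq_zero (σ ^ n)).1 (Subtype.ext (congrFun h0 i))
  have hj : ∀ i : Fin 4, ∃ j, ev j = ((σ ^ (i : ℕ)) gen : ℝ) := fun i =>
    exists_eq_of_hasEigenvalue (act A) hinj (fun i => (hev i).1)
      (Module.End.hasEigenvalue_of_hasEigenvector ⟨hlin i, hne i⟩)
  choose j hj using hj
  have hjinj : Function.Injective j := by
    intro i i' hii
    have h1 : (σ ^ (i : ℕ)) gen = (σ ^ (i' : ℕ)) gen := Subtype.ext (by rw [← hj, ← hj, hii])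
    have h2 : σ ^ (i : ℕ) = σ ^ (i' : ℕ) := by
      refine algHom_ext_of_eq_adjoin ℚ rfl ?_
      rintro _ rfl
      exact h1
    have h3 := congrArg (fun f : ℚ⟮ev 0⟯ →ₐ[ℚ] ℚ⟮ev 0⟯ => f (z 0)) h2
    simp only [hσpow] at h3
    simpa using hz h3
  have hline : ∀ i : Fin 4, l (j i) =
      Submodule.span ℝ {algebraMap ℚ⟮ev 0⟯ ℝ ∘ ((σ ^ (i : ℕ)) ∘ y)} := by
    intro i
    have h1 := hlin i
    rw [← hj, hx] at h1
    obtain ⟨c, hc⟩ := Submodule.mem_span_singleton.1 h1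
    have hc0 : c ≠ 0 := by
      rintro rfl
      exact hne i (by rw [← hc, zero_smul])
    rw [hlx, ← hc, Submodule.span_singleton_smul_eq (IsUnit.mk0 c hc0)]
  have hGn : ∀ n : ℕ, act G (algebraMap ℚ⟮ev 0⟯ ℝ ∘ ((σ ^ n) ∘ y)) =
      algebraMap ℚ⟮ev 0⟯ ℝ ∘ ((σ ^ (n + 1)) ∘ y) := by
    intro n
    rw [act_comp_algebraMap]
    have h1 := comp_intMatrix_mulVec ((σ ^ n : ℚ⟮ev 0⟯ →ₐ[ℚ] ℚ⟮ev 0⟯) : ℚ⟮ev 0⟯ →+* ℚ⟮ev 0⟯)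
      (G : Matrix (Fin 4) (Fin 4) ℤ) y
    rw [hG] at h1
    rw [pow_succ]
    exact congrArg (fun t => algebraMap ℚ⟮ev 0⟯ ℝ ∘ t) h1.symm
  let e : Equiv.Perm (Fin 4) := Equiv.ofBijective j (Finite.injective_iff_bijective.1 hjinj)
  obtain ⟨hs, hsupp, hse⟩ := isCycle_conj_finRotate e
  refine ⟨_, hs, hsupp, fun i => ?_⟩
  obtain ⟨i, rfl⟩ := e.surjective i
  have hei : ∀ i, e i = j i := fun i => rfl
  rw [hse, hei, hei, hline, hline, Submodule.map_span, Set.image_singleton, hGn]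
  have hmod : σ ^ ((i : ℕ) + 1) = σ ^ ((i + 1 : Fin 4) : ℕ) := by
    rw [pow_eq_pow_mod ((i : ℕ) + 1) hσ4, Fin.val_add]
    rfl
  rw [hmod]

/-- The eigenvalue `1` provides a nonzero integer fixed vector, and the line through it meets a
sail. -/
theorem hasProperCyclicSymmetry_of_permutesBy {l : Fin 4 → Submodule ℝ (Fin 4 → ℝ)}
    (x : Module.Basis (Fin 4) ℝ (Fin 4 → ℝ)) (hx : ∀ i, l i = Submodule.span ℝ {x i})
    {G : Matrix.GeneralLinearGroup (Fin 4) ℤ} {s : Equiv.Perm (Fin 4)} (hs : s.IsCycle)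
    (hsupp : s.support = Finset.univ) (hG : PermutesBy l G s)
    (hdet : ((G : Matrix (Fin 4) (Fin 4) ℤ) - 1).det = 0) : HasProperCyclicSymmetry l := by
  refine ⟨G, ⟨hG.isSymmetry, s, hs, hsupp, hG⟩, ⟨hG.isSymmetry, fun hdir => ?_⟩, ?_⟩
  · -- different lines are spanned by different basis vectors
    have hs0 : s 0 ≠ 0 := by
      rw [← Equiv.Perm.mem_support, hsupp]
      exact Finset.mem_univ _
    have h0 : l 0 = l (s 0) := (hdir.2 0).symm.trans (hG 0)
    rw [hx, hx] at h0
    have h1 : x 0 ∈ Submodule.span ℝ {x (s 0)} := h0 ▸ Submodule.mem_span_singleton_self _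
    obtain ⟨c, hc⟩ := Submodule.mem_span_singleton.1 h1
    have h2 := congrArg (fun t => x.repr t 0) hc
    simp [Finsupp.single_eq_of_ne hs0.symm] at h2
  · obtain ⟨z, hz0, hz⟩ := Matrix.exists_mulVec_eq_zero_iff.2 hdet
    have hGz : act G (fun i => (z i : ℝ)) = fun i => (z i : ℝ) := by
      rw [Matrix.sub_mulVec, Matrix.one_mulVec, sub_eq_zero] at hz
      rw [act_apply]
      have h1 := comp_intMatrix_mulVec (Int.castRingHom ℝ) (G : Matrix (Fin 4) (Fin 4) ℤ) z
      have h2 : (G : Matrix (Fin 4) (Fin 4) ℤ).map (Int.castRingHom ℤ) = G := by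
        ext i j
        simp
      rw [h2, hz] at h1
      exact h1.symm
    have hzne : (fun i => (z i : ℝ)) ≠ 0 := fun h0 => hz0 (funext fun i => by
      simpa using congrFun h0 i)
    obtain ⟨C, hC, t, ht⟩ := exists_smul_mem_sail x hx ⟨z, rfl⟩ hzne
    exact ⟨C, hC, _, ht, by rw [map_smul, hGz]⟩

/-- For an equivalence `X v = μ F` with a vector `F` of a normal form, the symmetry is `X⁻¹ B X`,
where `B` is the matrix of the conjugation. -/
theorem hasProperCyclicSymmetry_of_normalForm
    {l : Fin 4 → Submodule ℝ (Fin 4 → ℝ)} {v : Fin 4 → ℝ} (hl : IsAlgebraicCF l)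
    (hv : l 0 = Submodule.span ℝ {v}) (hv0 : v 0 = 1) {a b c d : ℝ}
    (hw : IsCyclicConjugates ![a, b, c, d]) {k : Fin 7} (h : NormalForm v a b c d k) :
    HasProperCyclicSymmetry l ∧
      Module.finrank ℚ (IntermediateField.adjoin ℚ (Set.range v)) = 4 ∧
      Normal ℚ (IntermediateField.adjoin ℚ (Set.range v)) := by
  obtain ⟨A, hA, ev, hinj, hev⟩ := hl
  obtain ⟨x, hx⟩ := exists_basis_eigenspace (act A) hinj fun i => (hev i).1
  have hlx : ∀ i, l i = Submodule.span ℝ {x i} := fun i => (hev i).2.trans (hx i)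
  have hK := finrank_adjoin_eigenvalue hA (hev 0).1
  obtain ⟨y₀, hy₀⟩ := exists_comp_algebraMap_eq (hev 0).1 ((hev 0).2.symm.trans hv) hv0
  have hvK : ∀ i, v i ∈ ℚ⟮ev 0⟯ := fun i => by
    rw [← hy₀]
    exact (y₀ i).2
  obtain ⟨hL, hLv⟩ := adjoin_eq_of_normalForm hK hvK hw h
  refine ⟨?_, by rw [hLv, hK], by rw [hLv, ← hL]; exact hw.normal⟩
  have hwK : ∀ i, ![a, b, c, d] i ∈ ℚ⟮ev 0⟯ := mem_of_normalForm hvK h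
  let z : Fin 4 → ℚ⟮ev 0⟯ := fun i => ⟨![a, b, c, d] i, hwK i⟩
  have hzw : algebraMap ℚ⟮ev 0⟯ ℝ ∘ z = ![a, b, c, d] := rfl
  obtain ⟨σ, hσ⟩ : ∃ σ : ℚ⟮ev 0⟯ →ₐ[ℚ] ℚ⟮ev 0⟯, ∀ i, σ (z i) = z (i + 1) := by
    have htransfer : ∀ L K : IntermediateField ℚ ℝ, L = K → ∀ (w : Fin 4 → ℝ)
        (hwL : ∀ i, w i ∈ L) (hwK : ∀ i, w i ∈ K),
        (∃ s : L ≃ₐ[ℚ] L, ∀ i, (s ⟨w i, hwL i⟩ : ℝ) = w (i + 1)) →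
        ∃ σ : K →ₐ[ℚ] K, ∀ i, σ ⟨w i, hwK i⟩ = ⟨w (i + 1), hwK (i + 1)⟩ := by
      rintro L _ rfl w hwL hwK ⟨s, hs⟩
      exact ⟨s, fun i => Subtype.ext (hs i)⟩
    exact htransfer _ _ hL _ _ hwK hw.2
  have hz : Function.Injective z := fun i i' hii =>
    hw.injective (congrArg (algebraMap ℚ⟮ev 0⟯ ℝ) hii)
  obtain ⟨⟨X, μ, hμ, hX⟩, htr⟩ := (normalForm_iff _ _ _ _ _ _).1 h
  -- `y` is the multiple of the eigenvector `v` that corresponds to the vector of the normal form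
  set F : Fin 4 → ℚ⟮ev 0⟯ := frame (z 0) (z 1) (z 2) k with hF
  have hFR : algebraMap ℚ⟮ev 0⟯ ℝ ∘ F = frame a b c k := map_frame _ _ _ _ _
  set XI := ((X⁻¹ : Matrix.GeneralLinearGroup (Fin 4) ℤ) :
    Matrix (Fin 4) (Fin 4) ℤ).map (Int.castRingHom ℚ⟮ev 0⟯) with hXI
  set XK := (X : Matrix (Fin 4) (Fin 4) ℤ).map (Int.castRingHom ℚ⟮ev 0⟯) with hXK
  have hXX : XK * XI = 1 := by
    rw [hXI, hXK, ← Matrix.map_mul, ← Units.val_mul, mul_inv_cancel, Units.val_one,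
      Matrix.map_one _ (map_zero _) (map_one _)]
  have hσF : σ ∘ F = frame (z 1) (z 2) (z 3) k := by
    have h1 := map_frame (σ : ℚ⟮ev 0⟯ →+* ℚ⟮ev 0⟯) (z 0) (z 1) (z 2) k
    refine h1.trans ?_
    simp only [AlgHom.coe_toRingHom, hσ]
    rfl
  have hBF : (frameMatrix k).map (Int.castRingHom ℚ⟮ev 0⟯) *ᵥ F = σ ∘ F := by
    rw [hσF]
    refine frameMatrix_mulVec ((algebraMap ℚ⟮ev 0⟯ ℝ).injective ?_)
    rw [map_intCast, ← htr]
    rfl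
  have hXF : XK *ᵥ (XI *ᵥ F) = F := by
    rw [Matrix.mulVec_mulVec, hXX, Matrix.one_mulVec]
  obtain ⟨s, hs, hsupp, hperm⟩ := exists_permutesBy (G := X⁻¹ * frameGL k * X) (σ := σ)
    (y := XI *ᵥ F) hinj hev
    (by
      intro h0
      rw [h0, Matrix.mulVec_zero] at hXF
      have := congrFun hXF 0
      rw [hF, frame_zero] at this
      exact zero_ne_one this)
    (by
      rw [hXI, ← act_comp_algebraMap, hFR]
      have h1 : frame a b c k = μ⁻¹ • act X v := by rw [hX, inv_smul_smul₀ hμ]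
      rw [h1, map_smul, act_inv_act, hv]
      exact Submodule.smul_mem _ _ (Submodule.mem_span_singleton_self v))
    (by
      rw [Units.val_mul, Units.val_mul, Matrix.map_mul, Matrix.map_mul, ← Matrix.mulVec_mulVec,
        ← Matrix.mulVec_mulVec, hXF, coe_frameGL, hBF, hXI]
      exact (comp_intMatrix_mulVec (σ : ℚ⟮ev 0⟯ →+* ℚ⟮ev 0⟯) _ F).symm)
    hz hσ (by rw [hzw, hL])
  refine hasProperCyclicSymmetry_of_permutesBy x hlx hs hsupp hperm ?_
  have h1 : ((X⁻¹ * frameGL k * X : Matrix.GeneralLinearGroup (Fin 4) ℤ) :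
      Matrix (Fin 4) (Fin 4) ℤ) - 1 =
      ((X⁻¹ : Matrix.GeneralLinearGroup (Fin 4) ℤ) : Matrix (Fin 4) (Fin 4) ℤ) *
        (frameMatrix k - 1) * X := by
    rw [Matrix.mul_sub, Matrix.sub_mul, Matrix.mul_one, ← Units.val_mul, inv_mul_cancel,
      Units.val_one, Units.val_mul, Units.val_mul, coe_frameGL]
  rw [h1, Matrix.det_mul, Matrix.det_mul, det_frameMatrix_sub_one, mul_zero, zero_mul]

end KleinCF

theorem mainTheorem2 (l : Fin 4 → Submodule ℝ (Fin 4 → ℝ)) (α β γ : ℝ)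
    (hl : KleinCF.IsAlgebraicCF l)
    (hl₁ : l 0 = Submodule.span ℝ {![1, α, β, γ]}) :
    (KleinCF.HasProperCyclicSymmetry l ↔
      ∃ a b c d : ℝ, KleinCF.IsCyclicConjugates ![a, b, c, d] ∧
        ∃ k, KleinCF.NormalForm ![1, α, β, γ] a b c d k) ∧
    ((∃ a b c d : ℝ, KleinCF.IsCyclicConjugates ![a, b, c, d] ∧
        ∃ k, KleinCF.NormalForm ![1, α, β, γ] a b c d k) →
      Module.finrank ℚ (IntermediateField.adjoin ℚ ({α, β, γ} : Set ℝ)) = 4 ∧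
      Normal ℚ (IntermediateField.adjoin ℚ ({α, β, γ} : Set ℝ))) := by
  have hadj : IntermediateField.adjoin ℚ (Set.range ![1, α, β, γ]) =
      IntermediateField.adjoin ℚ ({α, β, γ} : Set ℝ) := by
    refine le_antisymm ?_ (IntermediateField.adjoin.mono _ _ _ ?_)
    · rw [IntermediateField.adjoin_le_iff]
      rintro _ ⟨i, rfl⟩
      fin_cases i
      · exact one_mem _
      all_goals exact IntermediateField.subset_adjoin ℚ _ (by simp)
    · rintro _ (rfl | rfl | rfl)
      exacts [⟨1, rfl⟩, ⟨2, rfl⟩, ⟨3, rfl⟩]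
  refine ⟨⟨KleinCF.exists_normalForm_of_hasProperCyclicSymmetry hl hl₁ rfl, ?_⟩, ?_⟩
  · rintro ⟨a, b, c, d, hw, k, h⟩
    exact (KleinCF.hasProperCyclicSymmetry_of_normalForm hl hl₁ rfl hw h).1
  · rintro ⟨a, b, c, d, hw, k, h⟩
    rw [← hadj]
    exact (KleinCF.hasProperCyclicSymmetry_of_normalForm hl hl₁ rfl hw h).2
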